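/- Let $n\ge 2$ and let $O_n$ be the Cuntz algebra, i.e. the universal unital $C^*$-algebra generated by isometries $S_1,\dots,S_n$ with $\sum_i S_iS_i^*=1$. For a finite word $\mu=\mu_1\cdots\mu_k$ in $\{1,\dots,n\}$ put $S_\mu=S_{\mu_1}\cdots S_{\mu_k}$ and $|\mu|=k$ (with $S_\emptyset=1$), and let $O_{nc}=\mathrm{span}\{S_\mu S_\nu^*\}$. Let $\gamma$ be the gauge action of $\mathbb T$ on $O_n$, $\gamma_z(S_i)=zS_i$, let $F$ be its fixed point algebra, $\Phi(a)=\frac1{2\pi}\int_0^{2\pi}\gamma_{e^{i\theta}}(a)\,d\theta$ the expectation $O_n\to F$, and $\tau$ the (unique) faithful normalised trace on $F$. Let $\mathcal H=L^2(O_n)$ be the completion of $O_n$ for $\langle a,b\rangle=(\tau\circ\Phi)(a^*b)$, on which $O_n$ acts by left multiplication. Let $\mathcal D$ be the closure of the operator on $O_{nc}\subset\mathcal H$ given by $\mathcal D(S_\mu S_\nu^*)=(|\mu|-|\nu|)S_\mu S_\nu^*$. The antilinear operator $a\mapsto a^*$ on $O_{nc}\subset\mathcal H$ is closable. Let $S$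 be its closure and $\Delta=S^*S$. Then: 1. $S=J\Delta^{1/2}$ (with equality of domains) for an antilinear isometry $J$ of $\mathcal H$ with $J^2=1$. 2. For all finite words $\mu,\nu$, the vector $S_\mu S_\nu^*$ lies in the domain of $\Delta$ and $$\Delta\, S_\mu S_\nu^*=n^{|\nu|-|\mu|}S_\mu S_\nu^*.$$ 3. The modular automorphism group is given, for all $t\in\mathbb R$ and all finite words $\mu,\nu$, by $$\sigma_t(S_\mu S_\nu^*)=\Delta^{it}S_\mu S_\nu^*\Delta^{-it}=n^{it(|\nu|-|\mu|)}S_\mu S_\nu^*$$ as operators on $\mathcal H$. 4. $\mathcal D$ is self-adjoint and generates the gauge action: $e^{it\mathcal D}a=\gamma_{e^{it}}(a)$ for $a\in O_n\subset\mathcal H$ and $t\in\mathbb R$. Moreover $$\Delta=e^{-\mathcal D\log n}\qquad\text{and}\qquad e^{it\mathcal D}=e^{-\frac{it}{\log n}\log\Delta}\quad(t\in\mathbb R).$$ -/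

import Mathlib

open scoped ComplexOrder InnerProductSpace ComplexConjugate
open MeasureTheory Filter Topology

noncomputable section

/-! ## The Cuntz algebra, its gauge action and its KMS state -/

/-- A Cuntz family: `n` isometries in a unital C⋆-algebra whose range projections sum to `1`. -/
structure IsCuntzFamily {n : ℕ} {B : Type*} [CStarAlgebra B] (T : Fin n → B) : Prop where
  isometry : ∀ i, star (T i) * T i = 1
  sum_range : ∑ i, T i * star (T i) = 1

/-- `A`, with the generators `S 0, …, S (n - 1)`, is the Cuntz algebra `O_n`: the universal unital
C⋆-algebra generated by a Cuntz family. -/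
structure IsCuntzAlgebra.{u} {n : ℕ} {A : Type u} [CStarAlgebra A] (S : Fin n → A) : Prop where
  family : IsCuntzFamily S
  generates : (StarAlgebra.adjoin ℂ (Set.range S)).topologicalClosure = ⊤
  universal : ∀ (B : Type u) [CStarAlgebra B] (T : Fin n → B), IsCuntzFamily T →
    ∃ φ : A →⋆ₐ[ℂ] B, ∀ i, φ (S i) = T i

/-- `S_μ = S_{μ₁} ⋯ S_{μ_k}` for a finite word `μ`; the empty word gives `1`. -/
def cuntzWord {n : ℕ} {A : Type*} [CStarAlgebra A] (S : Fin n → A) (μ : List (Fin n)) : A :=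
  (μ.map S).prod

/-- The element `S_μ S_ν^*`. -/
def cuntzMonomial {n : ℕ} {A : Type*} [CStarAlgebra A] (S : Fin n → A) (μ ν : List (Fin n)) : A :=
  cuntzWord S μ * star (cuntzWord S ν)

/-- The dense subalgebra `O_{nc} = span {S_μ S_ν^*}` (as a linear subspace). -/
def cuntzCore {n : ℕ} {A : Type*} [CStarAlgebra A] (S : Fin n → A) : Submodule ℂ A :=
  Submodule.span ℂ {a | ∃ μ ν, a = cuntzMonomial S μ ν}

theorem star_mem_cuntzCore {n : ℕ} {A : Type*} [CStarAlgebra A] (S : Fin n → A) {a : A}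
    (ha : a ∈ cuntzCore S) : star a ∈ cuntzCore S := by
  induction ha using Submodule.span_induction with
  | mem x hx =>
    obtain ⟨μ, ν, rfl⟩ := hx
    exact Submodule.subset_span ⟨ν, μ, by simp [cuntzMonomial]⟩
  | zero => simp
  | add x y _ _ hx hy => rw [star_add]; exact add_mem hx hy
  | smul c x _ hx => rw [star_smul]; exact Submodule.smul_mem _ _ hx

namespace IsCuntzAlgebra

variable {n : ℕ} {A : Type*} [CStarAlgebra A] {S : Fin n → A}

theorem isCuntzFamily_smul (h : IsCuntzAlgebra S) (z : Circle) :
    IsCuntzFamily (fun i => (z : ℂ) • S i) := by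
  have hz : star (z : ℂ) * z = 1 := by
    rw [Complex.star_def, ← Circle.coe_inv_eq_conj, ← Circle.coe_mul]; simp
  constructor
  · intro i
    simp only [star_smul, smul_mul_smul_comm, hz, one_smul, h.family.isometry]
  · simp only [star_smul, smul_mul_smul_comm, mul_comm (z : ℂ), hz, one_smul, h.family.sum_range]

/-- The gauge action: `γ_z` is the endomorphism of `O_n` with `γ_z (S_i) = z S_i`, which exists by
the universal property. -/
def gauge (h : IsCuntzAlgebra S) (z : Circle) : A →⋆ₐ[ℂ] A :=
  (h.universal A _ (h.isCuntzFamily_smul z)).choose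

theorem gauge_apply (h : IsCuntzAlgebra S) (z : Circle) (i : Fin n) :
    h.gauge z (S i) = (z : ℂ) • S i :=
  (h.universal A _ (h.isCuntzFamily_smul z)).choose_spec i

theorem continuous_hom (φ : A →⋆ₐ[ℂ] A) : Continuous φ :=
  AddMonoidHomClass.continuous_of_bound φ 1 fun a => by
    simpa using NonUnitalStarAlgHom.norm_apply_le φ a

/-- Unital star homomorphisms are determined by their values on the generators. -/
theorem hom_ext (h : IsCuntzAlgebra S) {φ ψ : A →⋆ₐ[ℂ] A} (H : ∀ i, φ (S i) = ψ (S i)) :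
    φ = ψ := by
  have hφ : Continuous φ := continuous_hom φ
  have hψ : Continuous ψ := continuous_hom ψ
  ext a
  have ha : a ∈ (StarAlgebra.adjoin ℂ (Set.range S)).topologicalClosure := by
    rw [h.generates]; trivial
  have hcl : IsClosed {a | φ a = ψ a} := isClosed_eq hφ hψ
  refine closure_minimal (fun b hb => ?_) hcl ha
  induction hb using StarAlgebra.adjoin_induction with
  | mem x hx => obtain ⟨i, rfl⟩ := hx; exact H i
  | algebraMap r => simp [AlgHomClass.commutes]
  | add x y _ _ hx hy => simp only [Set.mem_ofPred_eq] at *; simp [hx, hy]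
  | mul x y _ _ hx hy => simp only [Set.mem_ofPred_eq] at *; simp [hx, hy]
  | star x _ hx => simp only [Set.mem_ofPred_eq] at *; simp [map_star, hx]

theorem gauge_mul (h : IsCuntzAlgebra S) (w z : Circle) (a : A) :
    h.gauge w (h.gauge z a) = h.gauge (w * z) a := by
  have : (h.gauge w).comp (h.gauge z) = h.gauge (w * z) := by
    refine h.hom_ext fun i => ?_
    simp [gauge_apply, map_smul, smul_smul, mul_comm]
  exact DFunLike.congr_fun this a

/-- The gauge action is strongly continuous. -/
theorem continuous_gauge (h : IsCuntzAlgebra S) (a : A) : Continuous fun z => h.gauge z a := by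
  have hcl : IsClosed {a | Continuous fun z => h.gauge z a} := by
    refine isClosed_of_closure_subset fun a ha => ?_
    rw [Metric.mem_closure_iff] at ha
    refine continuous_of_uniform_approx_of_continuous fun u hu => ?_
    obtain ⟨ε, hε, hu⟩ := Metric.mem_uniformity_dist.1 hu
    obtain ⟨b, hb, hab⟩ := ha ε hε
    refine ⟨_, hb, fun z => hu ?_⟩
    rw [dist_eq_norm, ← map_sub]
    refine (NonUnitalStarAlgHom.norm_apply_le (h.gauge z) _).trans_lt ?_
    rwa [← dist_eq_norm]
  have ha : a ∈ (StarAlgebra.adjoin ℂ (Set.range S)).topologicalClosure := by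
    rw [h.generates]; trivial
  refine closure_minimal (fun b hb => ?_) hcl ha
  induction hb using StarAlgebra.adjoin_induction with
  | mem x hx =>
    obtain ⟨i, rfl⟩ := hx
    simp only [Set.mem_ofPred_eq, gauge_apply]
    fun_prop
  | algebraMap r => simp only [Set.mem_ofPred_eq, AlgHomClass.commutes]; fun_prop
  | add x y _ _ hx hy => simp only [Set.mem_ofPred_eq, map_add] at *; exact hx.add hy
  | mul x y _ _ hx hy => simp only [Set.mem_ofPred_eq, map_mul] at *; exact hx.mul hy
  | star x _ hx => simp only [Set.mem_ofPred_eq, map_star] at *; exact hx.star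

/-- The fixed point algebra `F` of the gauge action. -/
def fixedPoints (h : IsCuntzAlgebra S) : StarSubalgebra ℂ A where
  carrier := {a | ∀ z, h.gauge z a = a}
  mul_mem' ha hb z := by rw [map_mul, ha z, hb z]
  add_mem' ha hb z := by rw [map_add, ha z, hb z]
  algebraMap_mem' r z := AlgHomClass.commutes _ r
  star_mem' ha z := by rw [map_star, ha z]

theorem intervalIntegrable_gauge (h : IsCuntzAlgebra S) (a : A) (s t : ℝ) :
    IntervalIntegrable (fun θ : ℝ => h.gauge (Circle.exp θ) a) volume s t :=
  ((h.continuous_gauge a).comp Circle.exp.continuous).intervalIntegrable _ _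

/-- `Φ(a) = (1 / 2π) ∫₀^{2π} γ_{exp(iθ)}(a) dθ`. -/
def average (h : IsCuntzAlgebra S) (a : A) : A :=
  ((2 * Real.pi)⁻¹ : ℝ) • ∫ θ in (0 : ℝ)..(2 * Real.pi), h.gauge (Circle.exp θ) a

theorem average_mem (h : IsCuntzAlgebra S) (a : A) : h.average a ∈ h.fixedPoints := by
  intro w
  obtain ⟨s, rfl⟩ := Circle.exp_surjective w
  have hc : Continuous (h.gauge (Circle.exp s)) := continuous_hom _
  let L : A →L[ℝ] A :=
    ⟨((h.gauge (Circle.exp s)).toAlgHom.toLinearMap).restrictScalars ℝ, hc⟩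
  have hL : ∀ x, h.gauge (Circle.exp s) x = L x := fun _ => rfl
  have hper : Function.Periodic (fun θ : ℝ => h.gauge (Circle.exp θ) a) (2 * Real.pi) := by
    intro θ; simp only [Circle.periodic_exp θ]
  unfold average
  rw [hL, map_smul, ← L.intervalIntegral_comp_comm (h.intervalIntegrable_gauge a _ _)]
  congr 1
  simp only [← hL, gauge_mul, ← Circle.exp_add]
  rw [intervalIntegral.integral_comp_add_left (fun θ : ℝ => h.gauge (Circle.exp θ) a) s]
  simpa using hper.intervalIntegral_add_eq s 0

/-- The conditional expectation `Φ : O_n → F`. -/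
def expectation (h : IsCuntzAlgebra S) : A →ₗ[ℂ] h.fixedPoints where
  toFun a := ⟨h.average a, h.average_mem a⟩
  map_add' a b := by
    apply Subtype.ext
    simp only [average, map_add, AddMemClass.mk_add_mk]
    rw [intervalIntegral.integral_add (h.intervalIntegrable_gauge a _ _)
      (h.intervalIntegrable_gauge b _ _), smul_add]
  map_smul' c a := by
    apply Subtype.ext
    simp only [average, map_smul, RingHom.id_apply, SetLike.val_smul]
    rw [intervalIntegral.integral_smul, smul_comm]

/-- `τ` is a faithful normalised trace on `F` (there is exactly one). -/
structure IsFaithfulNormalizedTrace (h : IsCuntzAlgebra S) (τ : h.fixedPoints →ₗ[ℂ] ℂ) :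
    Prop where
  map_one : τ 1 = 1
  nonneg : ∀ a, 0 ≤ τ (star a * a)
  trace : ∀ a b, τ (a * b) = τ (b * a)
  faithful : ∀ a, τ (star a * a) = 0 → a = 0

theorem average_nonneg [PartialOrder A] [StarOrderedRing A] (h : IsCuntzAlgebra S) {a : A}
    (ha : 0 ≤ a) : 0 ≤ h.average a := by
  have hpi : (0 : ℝ) ≤ 2 * Real.pi := by positivity
  refine smul_nonneg (by positivity) ?_
  rw [intervalIntegral.integral_of_le hpi]
  exact integral_nonneg fun θ => map_nonneg (h.gauge _) ha

theorem exists_fixed_sqrt [PartialOrder A] [StarOrderedRing A] (h : IsCuntzAlgebra S)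
    (x : h.fixedPoints) (hx : 0 ≤ (x : A)) : ∃ b : h.fixedPoints, x = star b * b := by
  have hs : 0 ≤ CFC.sqrt (x : A) := CFC.sqrt_nonneg _
  refine ⟨⟨CFC.sqrt (x : A), fun z => ?_⟩, Subtype.ext ?_⟩
  · refine ((CFC.sqrt_eq_iff (x : A) _ hx (map_nonneg (h.gauge z) hs)).2 ?_).symm
    rw [← map_mul, CFC.sqrt_mul_sqrt_self (x : A) hx]
    exact x.2 z
  · change (x : A) = star (CFC.sqrt (x : A)) * CFC.sqrt (x : A)
    rw [hs.isSelfAdjoint.star_eq, CFC.sqrt_mul_sqrt_self (x : A) hx]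

/-- The KMS state `τ ∘ Φ` on `O_n`. -/
def kmsState [PartialOrder A] [StarOrderedRing A] (h : IsCuntzAlgebra S)
    (τ : h.fixedPoints →ₗ[ℂ] ℂ) (hτ : h.IsFaithfulNormalizedTrace τ) : A →ₚ[ℂ] ℂ :=
  PositiveLinearMap.mk₀ (τ ∘ₗ h.expectation) fun a ha => by
    obtain ⟨b, hb⟩ := h.exists_fixed_sqrt (h.expectation a) (h.average_nonneg ha)
    simp only [LinearMap.comp_apply, hb]
    exact hτ.nonneg b

theorem kmsState_apply [PartialOrder A] [StarOrderedRing A] (h : IsCuntzAlgebra S)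
    (τ : h.fixedPoints →ₗ[ℂ] ℂ) (hτ : h.IsFaithfulNormalizedTrace τ) (a : A) :
    h.kmsState τ hτ a = τ (h.expectation a) := rfl

end IsCuntzAlgebra

/-! ## Antilinear unbounded operators -/

/-- An antilinear relation on `H`: an additive subgroup of `H × H` stable under
`(ξ, η) ↦ (c ξ, conj c η)`; the graph of an antilinear operator is of this form. -/
structure AntilinearRel (H : Type*) [AddCommGroup H] [Module ℂ H] where
  graph : AddSubgroup (H × H)
  smul_mem : ∀ (c : ℂ) (p : H × H), p ∈ graph → (c • p.1, conj c • p.2) ∈ graph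

namespace AntilinearRel

variable {H : Type*} [NormedAddCommGroup H] [InnerProductSpace ℂ H]

/-- The closure in `H × H`. -/
def closure (G : AntilinearRel H) : AntilinearRel H where
  graph := G.graph.topologicalClosure
  smul_mem c p hp := by
    have hc : Continuous fun p : H × H => (c • p.1, conj c • p.2) := by fun_prop
    exact map_mem_closure (f := fun p : H × H => (c • p.1, conj c • p.2)) hc hp
      fun q hq => G.smul_mem c q hq

/-- The relation is the graph of an operator. -/
def IsFunctional (G : AntilinearRel H) : Prop :=
  ∀ η, ((0 : H), η) ∈ G.graph → η = 0

theorem IsFunctional.eq {G : AntilinearRel H} (hG : G.IsFunctional) {ξ η ζ : H}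
    (h₁ : (ξ, η) ∈ G.graph) (h₂ : (ξ, ζ) ∈ G.graph) : η = ζ := by
  have := G.graph.sub_mem h₁ h₂
  rw [Prod.mk_sub_mk, sub_self] at this
  exact sub_eq_zero.1 (hG _ this)

open scoped Classical in
/-- The antilinear operator with graph `G`; if `G` is not the graph of an operator, it is `0`. -/
def toOperator (G : AntilinearRel H) : H →ₛₗ.[starRingEnd ℂ] H where
  domain :=
    { carrier := {ξ | ∃ η, (ξ, η) ∈ G.graph}
      zero_mem' := ⟨0, G.graph.zero_mem⟩
      add_mem' := fun ⟨η, hη⟩ ⟨ζ, hζ⟩ => ⟨η + ζ, G.graph.add_mem hη hζ⟩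
      smul_mem' := fun c _ ⟨η, hη⟩ => ⟨conj c • η, G.smul_mem c _ hη⟩ }
  toFun := if hG : G.IsFunctional then
    { toFun := fun ξ => ξ.2.choose
      map_add' := fun x y => hG.eq (x + y).2.choose_spec
        (G.graph.add_mem x.2.choose_spec y.2.choose_spec)
      map_smul' := fun c x => hG.eq (c • x).2.choose_spec (G.smul_mem c _ x.2.choose_spec) }
    else 0

theorem toOperator_apply {G : AntilinearRel H} (hG : G.IsFunctional) (ξ : G.toOperator.domain) :
    ((ξ : H), G.toOperator ξ) ∈ G.graph := by
  have : G.toOperator ξ = ξ.2.choose := by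
    change G.toOperator.toFun ξ = _
    unfold toOperator
    simp only [dif_pos hG]
    rfl
  rw [this]
  exact ξ.2.choose_spec

end AntilinearRel

namespace AntilinearOperator

variable {H : Type*} [NormedAddCommGroup H] [InnerProductSpace ℂ H]

/-- The relation defining the adjoint of an antilinear operator:
`(η, ζ)` with `⟪T ξ, η⟫ = ⟪ζ, ξ⟫` for all `ξ` in the domain of `T`. -/
def adjointRel (T : H →ₛₗ.[starRingEnd ℂ] H) : AntilinearRel H where
  graph :=
    { carrier := {p | ∀ ξ : T.domain, ⟪T ξ, p.1⟫_ℂ = ⟪p.2, (ξ : H)⟫_ℂ}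
      zero_mem' := fun ξ => by simp
      add_mem' := fun hp hq ξ => by
        simp only [Prod.fst_add, Prod.snd_add, inner_add_left, inner_add_right, hp ξ, hq ξ]
      neg_mem' := fun hp ξ => by
        simp only [Prod.fst_neg, Prod.snd_neg, inner_neg_left, inner_neg_right, hp ξ] }
  smul_mem c p hp ξ := by
    have := hp ξ
    simp only [inner_smul_left, inner_smul_right, this, Complex.conj_conj]

/-- The adjoint `T^*` of a densely defined antilinear operator. -/
def adjoint (T : H →ₛₗ.[starRingEnd ℂ] H) : H →ₛₗ.[starRingEnd ℂ] H := (adjointRel T).toOperator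

/-- The composition `R T` of two antilinear operators, a linear operator
with domain `{ξ ∈ dom T | T ξ ∈ dom R}`. -/
def comp (R T : H →ₛₗ.[starRingEnd ℂ] H) : H →ₗ.[ℂ] H where
  domain :=
    { carrier := {ξ | ∃ hξ : ξ ∈ T.domain, T ⟨ξ, hξ⟩ ∈ R.domain}
      zero_mem' := ⟨T.domain.zero_mem, by
        have : T ⟨0, T.domain.zero_mem⟩ = 0 := T.map_zero
        rw [this]; exact R.domain.zero_mem⟩
      add_mem' := fun {ξ η} ⟨h₁, h₂⟩ ⟨h₃, h₄⟩ => ⟨T.domain.add_mem h₁ h₃, by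
        have : T ⟨ξ + η, T.domain.add_mem h₁ h₃⟩ = T ⟨ξ, h₁⟩ + T ⟨η, h₃⟩ :=
          T.map_add ⟨ξ, h₁⟩ ⟨η, h₃⟩
        rw [this]; exact R.domain.add_mem h₂ h₄⟩
      smul_mem' := fun c ξ ⟨h₁, h₂⟩ => ⟨T.domain.smul_mem c h₁, by
        have : T ⟨c • ξ, T.domain.smul_mem c h₁⟩ = conj c • T ⟨ξ, h₁⟩ :=
          T.map_smulₛₗ c ⟨ξ, h₁⟩
        rw [this]; exact R.domain.smul_mem _ h₂⟩ }
  toFun :=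
    { toFun := fun ξ => R ⟨T ⟨ξ, ξ.2.choose⟩, ξ.2.choose_spec⟩
      map_add' := fun ξ η => by
        rw [← R.map_add]
        congr 1
        apply Subtype.ext
        exact T.map_add ⟨ξ, ξ.2.choose⟩ ⟨η, η.2.choose⟩
      map_smul' := fun c ξ => by
        have h₁ : T ⟨(c • ξ :), (c • ξ).2.choose⟩ = conj c • T ⟨ξ, ξ.2.choose⟩ :=
          T.map_smulₛₗ c ⟨ξ, ξ.2.choose⟩
        have h₂ : R (conj c • ⟨T ⟨ξ, ξ.2.choose⟩, ξ.2.choose_spec⟩) =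
            conj (conj c) • R ⟨T ⟨ξ, ξ.2.choose⟩, ξ.2.choose_spec⟩ := R.map_smulₛₗ _ _
        rw [Complex.conj_conj] at h₂
        rw [RingHom.id_apply, ← h₂]
        congr 1
        exact Subtype.ext h₁ }

end AntilinearOperator

/-! ## Functional calculus of unbounded self-adjoint operators -/

/-- A projection-valued measure on the Borel sets of `ℝ`. -/
structure SpectralMeasure (H : Type*) [NormedAddCommGroup H] [InnerProductSpace ℂ H]
    [CompleteSpace H] where
  proj : Set ℝ → H →L[ℂ] H
  isStarProjection : ∀ s, MeasurableSet s → IsStarProjection (proj s)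
  univ : proj Set.univ = 1
  inter : ∀ s t, MeasurableSet s → MeasurableSet t → proj (s ∩ t) = proj s * proj t
  hasSum : ∀ s : ℕ → Set ℝ, (∀ i, MeasurableSet (s i)) → Pairwise (Function.onFun Disjoint s) →
    ∀ ξ, HasSum (fun i => proj (s i) ξ) (proj (⋃ i, s i) ξ)

namespace SpectralMeasure

variable {H : Type*} [NormedAddCommGroup H] [InnerProductSpace ℂ H] [CompleteSpace H]

theorem proj_empty (E : SpectralMeasure H) (ξ : H) : E.proj ∅ ξ = 0 := by
  have h := E.hasSum (fun _ => ∅) (fun _ => .empty) (fun _ _ _ => disjoint_bot_left) ξ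
  exact tendsto_nhds_unique tendsto_const_nhds h.summable.tendsto_atTop_zero

theorem re_inner_nonneg (E : SpectralMeasure H) {s : Set ℝ} (hs : MeasurableSet s) (ξ : H) :
    0 ≤ (⟪ξ, E.proj s ξ⟫_ℂ).re :=
  ((ContinuousLinearMap.nonneg_iff_isPositive _).1
    (E.isStarProjection s hs).nonneg).re_inner_nonneg_right ξ

/-- The finite measure `s ↦ ⟪ξ, E(s) ξ⟫`. -/
def measure (E : SpectralMeasure H) (ξ : H) : Measure ℝ :=
  Measure.ofMeasurable (fun s _ => ENNReal.ofReal (⟪ξ, E.proj s ξ⟫_ℂ).re)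
    (by simp [E.proj_empty])
    (fun s hs hd => by
      have h := (Complex.reCLM ∘L (innerSL ℂ ξ).restrictScalars ℝ).hasSum
        (E.hasSum s hs hd ξ)
      rw [← ENNReal.ofReal_tsum_of_nonneg (fun i => E.re_inner_nonneg (hs i) ξ) h.summable]
      congr 1
      exact h.tsum_eq.symm)

theorem measure_apply (E : SpectralMeasure H) (ξ : H) {s : Set ℝ} (hs : MeasurableSet s) :
    E.measure ξ s = ENNReal.ofReal (⟪ξ, E.proj s ξ⟫_ℂ).re :=
  Measure.ofMeasurable_apply s hs

/-- `T = ∫ f dE`: the domain of `T` is `{ξ | ∫ |f|² d⟪ξ, E ξ⟫ < ∞}`, and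
`⟪ξ, T ξ⟫ = ∫ f d⟪ξ, E ξ⟫` on it (by polarization this determines `T`). -/
def IsIntegral (E : SpectralMeasure H) (f : ℝ → ℂ) (T : H →ₗ.[ℂ] H) : Prop :=
  Measurable f ∧
  (∀ ξ : H, ξ ∈ T.domain ↔ Integrable (fun x => ‖f x‖ ^ 2) (E.measure ξ)) ∧
  ∀ ξ : T.domain, ⟪(ξ : H), T ξ⟫_ℂ = ∫ x, f x ∂(E.measure ξ)

end SpectralMeasure

/-- `R = f(T)` in the Borel functional calculus of the self-adjoint operator `T`:
`T = ∫ x dE` and `R = ∫ f dE` for a projection-valued measure `E` (the one of the spectral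
theorem, which is unique). In particular `T` is self-adjoint. -/
def IsBorelFunctionOf {H : Type*} [NormedAddCommGroup H] [InnerProductSpace ℂ H] [CompleteSpace H]
    (T : H →ₗ.[ℂ] H) (f : ℝ → ℂ) (R : H →ₗ.[ℂ] H) : Prop :=
  ∃ E : SpectralMeasure H, E.IsIntegral (fun x => (x : ℂ)) T ∧ E.IsIntegral f R

/-- A bounded operator as an unbounded operator with domain everything. -/
def everywhereDefined {H : Type*} [NormedAddCommGroup H] [InnerProductSpace ℂ H]
    (U : H →L[ℂ] H) : H →ₗ.[ℂ] H := (U : H →ₗ[ℂ] H).toPMap ⊤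

/-! ## Modular theory on the GNS space -/

section Modular

variable {n : ℕ} {A : Type*} [CStarAlgebra A] [PartialOrder A] [StarOrderedRing A]

/-- The vector of the GNS space `L²(A, ω)`, the completion of `A` for
`⟪a, b⟫ = ω (a^* b)`, given by `a ∈ A`. -/
def gnsVector (ω : A →ₚ[ℂ] ℂ) (a : A) : ω.GNS := ((ω.toPreGNS a : ω.PreGNS) : ω.GNS)

theorem gnsVector_add (ω : A →ₚ[ℂ] ℂ) (a b : A) :
    gnsVector ω (a + b) = gnsVector ω a + gnsVector ω b := by
  simp [gnsVector, UniformSpace.Completion.coe_add]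

theorem gnsVector_smul (ω : A →ₚ[ℂ] ℂ) (c : ℂ) (a : A) :
    gnsVector ω (c • a) = c • gnsVector ω a := by
  simp [gnsVector, UniformSpace.Completion.coe_smul]

theorem inner_gnsVector (ω : A →ₚ[ℂ] ℂ) (a b : A) :
    ⟪gnsVector ω a, gnsVector ω b⟫_ℂ = ω (star a * b) := by
  simp [gnsVector, UniformSpace.Completion.inner_coe, PositiveLinearMap.preGNS_inner_def]

/-- The relation `{(a, a^*) | a ∈ O_{nc}}` on the GNS space. -/
def preTomita (S : Fin n → A) (ω : A →ₚ[ℂ] ℂ) : AntilinearRel ω.GNS where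
  graph :=
    { carrier := {p | ∃ a ∈ cuntzCore S, p = (gnsVector ω a, gnsVector ω (star a))}
      zero_mem' := ⟨0, zero_mem _, by
        have h : gnsVector ω 0 = 0 := by simpa using gnsVector_smul ω 0 0
        rw [star_zero, h]; rfl⟩
      add_mem' := by
        rintro _ _ ⟨a, ha, rfl⟩ ⟨b, hb, rfl⟩
        exact ⟨a + b, add_mem ha hb, by simp [gnsVector_add]⟩
      neg_mem' := by
        rintro _ ⟨a, ha, rfl⟩
        refine ⟨(-1 : ℂ) • a, Submodule.smul_mem _ _ ha, ?_⟩
        simp only [star_smul, gnsVector_smul]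
        simp }
  smul_mem := by
    rintro c _ ⟨a, ha, rfl⟩
    exact ⟨c • a, Submodule.smul_mem _ _ ha, by simp [star_smul, gnsVector_smul]⟩

/-- The Tomita operator: the closure of `a ↦ a^*` on `O_{nc}`. -/
def tomitaOperator (S : Fin n → A) (ω : A →ₚ[ℂ] ℂ) : ω.GNS →ₛₗ.[starRingEnd ℂ] ω.GNS :=
  (preTomita S ω).closure.toOperator

/-- The modular operator `Δ = S^* S` of the Tomita operator `S`. -/
def modularOperator (S : Fin n → A) (ω : A →ₚ[ℂ] ℂ) : ω.GNS →ₗ.[ℂ] ω.GNS :=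
  AntilinearOperator.comp (AntilinearOperator.adjoint (tomitaOperator S ω)) (tomitaOperator S ω)

/-- The operator `D` on the GNS space: the closure of the linear operator on `O_{nc}` with
`D (S_μ S_ν^*) = (|μ| - |ν|) S_μ S_ν^*`. -/
def gaugeGenerator (S : Fin n → A) (ω : A →ₚ[ℂ] ℂ) : ω.GNS →ₗ.[ℂ] ω.GNS :=
  (Submodule.span ℂ {p : ω.GNS × ω.GNS | ∃ μ ν : List (Fin n),
    p = (gnsVector ω (cuntzMonomial S μ ν),
      ((μ.length : ℂ) - (ν.length : ℂ)) • gnsVector ω (cuntzMonomial S μ ν))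
    }).topologicalClosure.toLinearPMap

end Modular

end

noncomputable section

/-! ## Diagonal operators for an orthogonal decomposition of a Hilbert space -/

/-! The GNS space is graded by the degree `k = |μ| - |ν|`. Averaging over the gauge action kills
every element of nonzero degree, so monomials of different degree are orthogonal, and
`degreeProjection` is an orthogonal decomposition of the space. All the linear operators of the
theorem act on degree `k` as a scalar: `D` by `k`, the gauge unitaries by `z ^ k`, `Δ` by `n ^
(-k)`. Once they are known to be diagonal with maximal domain, the functional calculus reduces to
scalar identities, because functions of a diagonal operator are integrals against one atomic
spectral measure (`isBorelFunctionOf_diagonalOperator`). The domains are controlled by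
`diagonalOperator_graph_eq`: eigenvectors spanning a dense subspace of each degree span a core.

The real content is that `Δ` is diagonal. The trace property on `F` and the Cuntz relations give
`ω(S_μ S_ν^*) = δ_{μν} n^{-|μ|}`, and from this the KMS relation `kmsState_cuntzMonomial_mul`:
moving a monomial of degree `k` from the left to the right of a product costs `n^{-k}`. Hence the
star operation, rescaled by `n^{k/2}` in degree `k`, reverses inner products and extends to an
antilinear isometric involution `J` (`exists_modular_conjugation`). Applying `J` to the second
coordinate carries the graph of the Tomita operator onto that of the diagonal operator `Q` with
eigenvalues `n^{-k/2}` (`mem_closure_preTomita_graph`). Thus `S = J Q`, which is closable, and `Δ =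
S^* S = Q²` (`adjoint_comp_self_of_polar`). -/

/-- A family of mutually orthogonal projections with sum `1`. -/
structure IsOrthogonalDecomposition {ι H : Type*} [NormedAddCommGroup H] [InnerProductSpace ℂ H]
    (P : ι → H →L[ℂ] H) : Prop where
  symm : ∀ i x y, ⟪P i x, y⟫_ℂ = ⟪x, P i y⟫_ℂ
  idem : ∀ i x, P i (P i x) = P i x
  ortho : ∀ i j, i ≠ j → ∀ x, P i (P j x) = 0
  hasSum : ∀ x, HasSum (fun i => P i x) x

theorem IsHilbertSum.isOrthogonalDecomposition {ι H : Type*} [NormedAddCommGroup H]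
    [InnerProductSpace ℂ H] [CompleteSpace H] {V : ι → Submodule ℂ H}
    [∀ i, CompleteSpace (V i)]
    (hV : IsHilbertSum ℂ (fun i => V i) (fun i => (V i).subtypeₗᵢ)) :
    IsOrthogonalDecomposition (fun i => (V i).starProjection) := by
  have hortho : ∀ i j, i ≠ j → ∀ x ∈ V j, (V i).starProjection x = 0 := by
    intro i j hij x hx
    rw [Submodule.starProjection_apply_eq_zero_iff, Submodule.mem_orthogonal]
    intro u hu
    exact hV.OrthogonalFamily hij ⟨u, hu⟩ ⟨x, hx⟩
  refine ⟨fun i x y => Submodule.inner_starProjection_left_eq_right _ x y, fun i x => ?_,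
    fun i j hij x => hortho i j hij _ (Submodule.starProjection_apply_mem _ _), fun x => ?_⟩
  · exact Submodule.starProjection_eq_self_iff.2 (Submodule.starProjection_apply_mem _ _)
  · obtain ⟨w, rfl⟩ := hV.linearIsometryEquiv.symm.surjective x
    have hw := hV.hasSum_linearIsometryEquiv_symm w
    convert hw using 2 with j
    have h1 := (V j).starProjection.hasSum hw
    have h2 := hasSum_single (f := fun i => (V j).starProjection ((V i).subtypeₗᵢ (w i))) j
      fun i hi => hortho j i hi.symm _ (w i).2
    rw [h1.unique h2]
    exact Submodule.starProjection_eq_self_iff.2 (w j).2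

namespace IsOrthogonalDecomposition

variable {ι H : Type*} [NormedAddCommGroup H] [InnerProductSpace ℂ H]
  {P : ι → H →L[ℂ] H}

theorem inner_apply_self (hP : IsOrthogonalDecomposition P)
    (i : ι) (x : H) : ⟪x, P i x⟫_ℂ = ((‖P i x‖ ^ 2 : ℝ) : ℂ) := by
  rw [← hP.idem, ← hP.symm, inner_self_eq_norm_sq_to_K, hP.idem]; simp

theorem ext (hP : IsOrthogonalDecomposition P) {x y : H} (h : ∀ i, P i x = P i y) : x = y :=
  (hP.hasSum x).unique (by simpa only [h] using hP.hasSum y)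

theorem hasSum_inner (hP : IsOrthogonalDecomposition P)
    (x y : H) : HasSum (fun i => ⟪x, P i y⟫_ℂ) ⟪x, y⟫_ℂ :=
  (innerSL ℂ x).hasSum (hP.hasSum y)

theorem inner_ext (hP : IsOrthogonalDecomposition P)
    {x y x' y' : H} (h : ∀ i, ⟪x, P i y⟫_ℂ = ⟪x', P i y'⟫_ℂ) :
    ⟪x, y⟫_ℂ = ⟪x', y'⟫_ℂ :=
  (hP.hasSum_inner x y).unique (by simpa only [h] using hP.hasSum_inner x' y')

theorem hasSum_norm_sq (hP : IsOrthogonalDecomposition P)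
    (x : H) : HasSum (fun i => ‖P i x‖ ^ 2) (‖x‖ ^ 2) := by
  have h := Complex.reCLM.hasSum (hP.hasSum_inner x x)
  simp only [hP.inner_apply_self, inner_self_eq_norm_sq_to_K] at h
  have hx : Complex.reCLM (((‖x‖ : ℝ) : ℂ) ^ 2) = ‖x‖ ^ 2 := by
    change (((‖x‖ : ℝ) : ℂ) ^ 2).re = _
    norm_cast
  exact hx ▸ h

/-- Continuity of `P i` allows applying it termwise, and orthogonality leaves only the `i`-th term.
This is how coordinates of infinite sums are read off throughout. -/
theorem apply_of_hasSum (hP : IsOrthogonalDecomposition P)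
    {v : ι → H} (hv : ∀ i, P i (v i) = v i) {x : H} (hx : HasSum v x) (i : ι) :
    P i x = v i := by
  have h2 := hasSum_single (f := fun j => P i (v j)) i fun j hj => by
    rw [← hv j]; exact hP.ortho i j hj.symm _
  rw [((P i).hasSum hx).unique h2, hv]

theorem summable_iff (hP : IsOrthogonalDecomposition P)
    [CompleteSpace H] {v : ι → H} (hv : ∀ i, P i (v i) = v i) :
    Summable v ↔ Summable fun i => ‖v i‖ ^ 2 := by
  have hV : OrthogonalFamily ℂ (fun i => LinearMap.range (P i).toLinearMap)
      (fun i => (LinearMap.range (P i).toLinearMap).subtypeₗᵢ) := by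
    rintro i j hij ⟨_, x, rfl⟩ ⟨_, y, rfl⟩
    change ⟪P i x, P j y⟫_ℂ = 0
    rw [hP.symm, hP.ortho i j hij, inner_zero_right]
  exact hV.summable_iff_norm_sq_summable fun i => ⟨v i, v i, hv i⟩

theorem apply_smul_apply (hP : IsOrthogonalDecomposition P)
    (f : ι → ℂ) (x : H) (i : ι) : P i (f i • P i x) = f i • P i x := by
  rw [map_smul, hP.idem]

theorem summable_smul_iff (hP : IsOrthogonalDecomposition P) [CompleteSpace H] (f : ι → ℂ) (x : H) :
    (Summable fun i => f i • P i x) ↔ Summable fun i => ‖f i‖ ^ 2 * ‖P i x‖ ^ 2 := by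
  rw [hP.summable_iff (hP.apply_smul_apply f x)]
  simp only [norm_smul, mul_pow]

end IsOrthogonalDecomposition

/-- The operator acting on the range of `P i` as the scalar `f i`, with its maximal domain. -/
def diagonalOperator {ι H : Type*} [NormedAddCommGroup H] [InnerProductSpace ℂ H]
    (P : ι → H →L[ℂ] H) (f : ι → ℂ) : H →ₗ.[ℂ] H where
  domain :=
    { carrier := {x | Summable fun i => f i • P i x}
      zero_mem' := by simp [summable_zero]
      add_mem' := fun {x y} hx hy => by
        simpa only [Set.mem_ofPred_eq, map_add, smul_add] using hx.add hy
      smul_mem' := fun c x hx => by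
        simpa only [Set.mem_ofPred_eq, map_smul, smul_comm (f _) c] using hx.const_smul c }
  toFun :=
    { toFun := fun x => ∑' i, f i • P i (x : H)
      map_add' := fun x y => by
        simpa only [Submodule.coe_add, map_add, smul_add] using x.2.tsum_add y.2
      map_smul' := fun c x => by
        simpa only [Submodule.coe_smul, map_smul, smul_comm (f _) c, RingHom.id_apply] using
          x.2.tsum_const_smul c }

namespace IsOrthogonalDecomposition

variable {ι H : Type*} [NormedAddCommGroup H] [InnerProductSpace ℂ H]
  {P : ι → H →L[ℂ] H} {f : ι → ℂ}

theorem mem_diagonalOperator_domain (hP : IsOrthogonalDecomposition P) [CompleteSpace H] {x : H} :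
    x ∈ (diagonalOperator P f).domain ↔ Summable fun i => ‖f i‖ ^ 2 * ‖P i x‖ ^ 2 :=
  hP.summable_smul_iff f x

theorem apply_diagonalOperator (hP : IsOrthogonalDecomposition P)
    (x : (diagonalOperator P f).domain) (i : ι) :
    P i (diagonalOperator P f x) = f i • P i x :=
  hP.apply_of_hasSum (hP.apply_smul_apply f x) (Summable.hasSum x.2) i

/-- No summability condition is needed on the right: the expansion of `p.2` already supplies the
convergence of `∑ f i • P i p.1`. The graph is therefore cut out by closed coordinate conditions, so
statements about domains become coordinatewise identities. -/
theorem mem_diagonalOperator_graph (hP : IsOrthogonalDecomposition P) {p : H × H} :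
    p ∈ (diagonalOperator P f).graph ↔ ∀ i, P i p.2 = f i • P i p.1 := by
  rw [LinearPMap.mem_graph_iff]
  constructor
  · rintro ⟨x, hx, hy⟩ i
    rw [← hx, ← hy, hP.apply_diagonalOperator]
  · intro h
    have hs : HasSum (fun i => f i • P i p.1) p.2 := by simpa only [h] using hP.hasSum p.2
    exact ⟨⟨p.1, hs.summable⟩, rfl, hs.tsum_eq⟩

theorem isClosed_diagonalOperator_graph (hP : IsOrthogonalDecomposition P) :
    IsClosed ((diagonalOperator P f).graph : Set (H × H)) := by
  have : ((diagonalOperator P f).graph : Set (H × H)) = ⋂ i, {p | P i p.2 = f i • P i p.1} := by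
    ext p
    simp only [SetLike.mem_coe, hP.mem_diagonalOperator_graph, Set.mem_iInter, Set.mem_ofPred_eq]
  rw [this]
  exact isClosed_iInter fun i => isClosed_eq (by fun_prop) (by fun_prop)

/-- Spanning sets of the ranges of the projections span a core of a diagonal operator. -/
theorem diagonalOperator_graph_eq (hP : IsOrthogonalDecomposition P)
    {X : ι → Set H} (hX : ∀ i, ∀ x ∈ X i, P i x = x)
    (hd : ∀ i x, P i x ∈ (Submodule.span ℂ (X i)).topologicalClosure) :
    (diagonalOperator P f).graph =
      (Submodule.span ℂ {p : H × H | ∃ i, ∃ x ∈ X i, p = (x, f i • x)}).topologicalClosure := by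
  apply le_antisymm
  · intro p hp
    rw [hP.mem_diagonalOperator_graph] at hp
    have hs : HasSum (fun i => (P i p.1, f i • P i p.1)) p := by
      have h2 : HasSum (fun i => f i • P i p.1) p.2 := by simpa only [hp] using hP.hasSum p.2
      exact (hP.hasSum p.1).prodMk h2
    refine (Submodule.isClosed_topologicalClosure _).mem_of_tendsto hs
      (Eventually.of_forall fun s => sum_mem fun i _ => ?_)
    -- On the range of one projection the operator is the bounded scalar `f i`, so approximating `P
    -- i p.1` by the span of `X i` also approximates its image; `L` carries out both at once.
    let L : H →L[ℂ] H × H := (ContinuousLinearMap.id ℂ H).prod (f i • ContinuousLinearMap.id ℂ H)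
    have hL : ∀ y ∈ (Submodule.span ℂ (X i)).topologicalClosure, L y ∈
        (Submodule.span ℂ {p : H × H | ∃ i, ∃ x ∈ X i, p = (x, f i • x)}).topologicalClosure := by
      intro y hy
      refine map_mem_closure L.continuous hy fun z hz => ?_
      induction hz using Submodule.span_induction with
      | mem x hx => exact Submodule.subset_span ⟨i, x, hx, rfl⟩
      | zero => rw [map_zero]; exact zero_mem _
      | add x y _ _ hx hy => rw [map_add]; exact add_mem hx hy
      | smul c x _ hx => rw [map_smul]; exact Submodule.smul_mem _ _ hx
    exact hL _ (hd i p.1)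
  · refine Submodule.topologicalClosure_minimal _ (Submodule.span_le.2 ?_)
      hP.isClosed_diagonalOperator_graph
    rintro _ ⟨i, x, hx, rfl⟩
    refine hP.mem_diagonalOperator_graph.2 fun j => ?_
    by_cases hij : j = i
    · subst hij; simp
    · have : P j x = 0 := by rw [← hX i x hx]; exact hP.ortho j i hij x
      simp [this]

/-! ### Bounded diagonal operators and the spectral measure of a real diagonal operator. -/

variable [CompleteSpace H]

theorem summable_of_norm_le_one (hP : IsOrthogonalDecomposition P) (hf : ∀ i, ‖f i‖ ≤ 1) (x : H) :
    Summable fun i => f i • P i x := by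
  rw [hP.summable_smul_iff]
  refine (hP.hasSum_norm_sq x).summable.of_nonneg_of_le (fun i => by positivity) fun i => ?_
  exact mul_le_of_le_one_left (by positivity) (pow_le_one₀ (norm_nonneg _) (hf i))

/-- The diagonal contraction with eigenvalues `f i` in the unit disc. -/
def contraction (hP : IsOrthogonalDecomposition P) (f : ι → ℂ) (hf : ∀ i, ‖f i‖ ≤ 1) : H →L[ℂ] H :=
  LinearMap.mkContinuous
    { toFun := fun x => ∑' i, f i • P i x
      map_add' := fun x y => by
        simpa only [map_add, smul_add] using
          (hP.summable_of_norm_le_one hf x).tsum_add (hP.summable_of_norm_le_one hf y)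
      map_smul' := fun c x => by
        simpa only [map_smul, smul_comm (f _) c, RingHom.id_apply] using
          (hP.summable_of_norm_le_one hf x).tsum_const_smul c }
    1 fun x => by
      rw [one_mul]
      refine le_of_sq_le_sq ?_ (norm_nonneg _)
      have h := hP.hasSum_norm_sq (∑' i, f i • P i x)
      refine hasSum_le (fun i => ?_) h (hP.hasSum_norm_sq x)
      rw [hP.apply_of_hasSum (hP.apply_smul_apply f x) (hP.summable_of_norm_le_one hf x).hasSum,
        norm_smul, mul_pow]
      exact mul_le_of_le_one_left (by positivity) (pow_le_one₀ (norm_nonneg _) (hf i))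

theorem hasSum_contraction (hP : IsOrthogonalDecomposition P) (hf : ∀ i, ‖f i‖ ≤ 1) (x : H) :
    HasSum (fun i => f i • P i x) (hP.contraction f hf x) :=
  (hP.summable_of_norm_le_one hf x).hasSum

theorem apply_contraction (hP : IsOrthogonalDecomposition P) (hf : ∀ i, ‖f i‖ ≤ 1) (x : H) (i : ι) :
    P i (hP.contraction f hf x) = f i • P i x :=
  hP.apply_of_hasSum (hP.apply_smul_apply f x) (hP.hasSum_contraction hf x) i

theorem everywhereDefined_contraction (hP : IsOrthogonalDecomposition P) (hf : ∀ i, ‖f i‖ ≤ 1) :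
    everywhereDefined (hP.contraction f hf) = diagonalOperator P f := by
  refine LinearPMap.ext (Submodule.ext fun x => ?_) fun x h₁ h₂ => ?_
  · exact iff_of_true trivial (hP.summable_of_norm_le_one hf x)
  · rfl

theorem norm_indicator_one_le (s : Set ι) (i : ι) : ‖s.indicator (1 : ι → ℂ) i‖ ≤ 1 := by
  by_cases h : i ∈ s <;> simp [h]

/-- The spectral measure with `E s` the sum of the projections `P i` with `l i ∈ s`. -/
def spectralMeasure (hP : IsOrthogonalDecomposition P) (l : ι → ℝ) : SpectralMeasure H where
  proj s := hP.contraction ((l ⁻¹' s).indicator 1) (norm_indicator_one_le _)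
  isStarProjection s _ := by
    refine ⟨ContinuousLinearMap.ext fun x => hP.ext fun i => ?_,
      ContinuousLinearMap.isSelfAdjoint_iff_isSymmetric.2 fun x y => ?_⟩
    · rw [mul_apply_eq_comp]
      simp only [apply_contraction]
      by_cases h : i ∈ l ⁻¹' s <;> simp [h]
    · refine hP.inner_ext fun i => ?_
      change ⟪hP.contraction _ _ x, P i y⟫_ℂ = ⟪x, P i (hP.contraction _ _ y)⟫_ℂ
      rw [← hP.symm]
      simp only [apply_contraction]
      by_cases h : i ∈ l ⁻¹' s <;> simp [h, hP.symm]
  univ := ContinuousLinearMap.ext fun x => hP.ext fun i => by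
    rw [apply_contraction]; simp
  inter s t _ _ := ContinuousLinearMap.ext fun x => hP.ext fun i => by
    rw [mul_apply_eq_comp]
    simp only [apply_contraction, Set.preimage_inter, smul_smul]
    rw [Set.inter_indicator_one]; rfl
  hasSum s _ hd x := by
    -- Each projection is rewritten as an unconditional sum over the indices with `l i ∈ t`;
    -- countable additivity is then regrouping over the disjoint preimages.
    have key : ∀ t : Set ℝ, HasSum (fun i : l ⁻¹' t => P i x)
        (hP.contraction ((l ⁻¹' t).indicator 1) (norm_indicator_one_le _) x) := by
      intro t
      have h := hP.hasSum_contraction (norm_indicator_one_le (l ⁻¹' t)) x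
      refine (hasSum_subtype_iff_indicator (f := fun i => P i x)).2 ?_
      convert h using 2 with i
      by_cases h : i ∈ l ⁻¹' t <;> simp [h]
    have hu := key (⋃ i, s i)
    have hd' : Pairwise (Function.onFun Disjoint fun i => l ⁻¹' s i) :=
      fun i j hij => (hd hij).preimage l
    have he : l ⁻¹' (⋃ i, s i) = ⋃ i, l ⁻¹' s i := Set.preimage_iUnion
    have hu2 : HasSum (fun i : (⋃ i, l ⁻¹' s i : Set ι) => P i x)
        (hP.contraction ((l ⁻¹' ⋃ i, s i).indicator 1) (norm_indicator_one_le _) x) := by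
      rw [he] at hu
      convert hu using 3
      rw [he]
    have hu3 := ((Set.unionEqSigmaOfDisjoint hd').symm.hasSum_iff).2 hu2
    exact hu3.sigma fun i => key (s i)

/-- `⟪x, E(s) x⟫` is the sum of `‖P i x‖ ^ 2` over the `i` with `l i ∈ s`, so the measure is purely
atomic. The values `l i` may repeat; their masses then add. -/
theorem measure_spectralMeasure (hP : IsOrthogonalDecomposition P) (l : ι → ℝ) (x : H) :
    (hP.spectralMeasure l).measure x =
      Measure.sum fun i => ENNReal.ofReal (‖P i x‖ ^ 2) • Measure.dirac (l i) := by
  refine Measure.ext fun s hs => ?_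
  rw [SpectralMeasure.measure_apply _ _ hs, Measure.sum_apply _ hs]
  have h := Complex.reCLM.hasSum
    (hP.hasSum_inner x ((hP.spectralMeasure l).proj s x))
  have he : ∀ i, Complex.reCLM ⟪x, P i ((hP.spectralMeasure l).proj s x)⟫_ℂ =
      (l ⁻¹' s).indicator (fun i => ‖P i x‖ ^ 2) i := by
    intro i
    change Complex.reCLM ⟪x, P i (hP.contraction ((l ⁻¹' s).indicator 1)
      (norm_indicator_one_le _) x)⟫_ℂ = _
    rw [apply_contraction, inner_smul_right, hP.inner_apply_self]
    by_cases h : i ∈ l ⁻¹' s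
    · simp only [h, Set.indicator_of_mem, Pi.one_apply, one_mul, Complex.reCLM_apply,
        Complex.ofReal_re]
    · simp only [h, not_false_eq_true, Set.indicator_of_notMem, zero_mul, map_zero]
  simp only [he] at h
  change ENNReal.ofReal (Complex.reCLM _) = _
  rw [← h.tsum_eq, ENNReal.ofReal_tsum_of_nonneg _ h.summable]
  · refine tsum_congr fun i => ?_
    rw [Measure.smul_apply, Measure.dirac_apply' _ hs]
    by_cases h : l i ∈ s <;> simp [h]
  · exact fun i => Set.indicator_nonneg (fun _ _ => by positivity) i

/-- Integrals against the atomic measure are series, and the square-integrability condition becomes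
exactly the summability defining the maximal domain. -/
theorem isIntegral_diagonalOperator (hP : IsOrthogonalDecomposition P)
    [Countable ι] (l : ι → ℝ) {g : ℝ → ℂ} (hg : Measurable g) :
    (hP.spectralMeasure l).IsIntegral g (diagonalOperator P fun i => g (l i)) := by
  refine ⟨hg, fun x => ?_, fun x => ?_⟩
  · rw [hP.mem_diagonalOperator_domain, measure_spectralMeasure,
      integrable_sum_dirac_iff fun i => ENNReal.ofReal_ne_top]
    refine summable_congr fun i => ?_
    rw [ENNReal.toReal_ofReal (by positivity), Real.norm_of_nonneg (by positivity), mul_comm]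
  · rw [measure_spectralMeasure, integral_sum_dirac fun i => ENNReal.ofReal_ne_top]
    rw [← (hP.hasSum_inner _ _).tsum_eq]
    refine tsum_congr fun i => ?_
    rw [hP.apply_diagonalOperator, inner_smul_right, hP.inner_apply_self,
      ENNReal.toReal_ofReal (by positivity), Complex.real_smul, mul_comm]

theorem isBorelFunctionOf_diagonalOperator (hP : IsOrthogonalDecomposition P)
    [Countable ι] (l : ι → ℝ) {g : ℝ → ℂ}
    (hg : Measurable g) :
    IsBorelFunctionOf (diagonalOperator P fun i => (l i : ℂ)) g
      (diagonalOperator P fun i => g (l i)) :=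
  ⟨hP.spectralMeasure l, hP.isIntegral_diagonalOperator l Complex.measurable_ofReal,
    hP.isIntegral_diagonalOperator l hg⟩

end IsOrthogonalDecomposition

/-! ## Monomials in the Cuntz algebra and the values of the KMS state on them -/

section Words

variable {n : ℕ} {A : Type*} [CStarAlgebra A] {S : Fin n → A}

@[simp] theorem cuntzWord_nil (S : Fin n → A) : cuntzWord S [] = 1 := rfl

@[simp] theorem cuntzWord_cons (S : Fin n → A) (i : Fin n) (μ : List (Fin n)) :
    cuntzWord S (i :: μ) = S i * cuntzWord S μ := by
  simp [cuntzWord]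

theorem cuntzWord_append (S : Fin n → A) (μ ν : List (Fin n)) :
    cuntzWord S (μ ++ ν) = cuntzWord S μ * cuntzWord S ν := by
  simp [cuntzWord]

theorem star_cuntzMonomial (S : Fin n → A) (μ ν : List (Fin n)) :
    star (cuntzMonomial S μ ν) = cuntzMonomial S ν μ := by
  simp [cuntzMonomial]

theorem mul_cuntzMonomial (S : Fin n → A) (i : Fin n) (μ ν : List (Fin n)) :
    S i * cuntzMonomial S μ ν = cuntzMonomial S (i :: μ) ν := by
  simp [cuntzMonomial, mul_assoc]

theorem cuntzMonomial_mem_cuntzCore (S : Fin n → A) (μ ν : List (Fin n)) :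
    cuntzMonomial S μ ν ∈ cuntzCore S :=
  Submodule.subset_span ⟨μ, ν, rfl⟩

/-! ### Cuntz relations for words; the span of the monomials is the star algebra generated by `S`.
-/

namespace IsCuntzFamily

/-- Conjugating `∑ S_i S_i^* = 1` by `S_j` writes `1` as a sum of positive elements whose `j`-th
term is already `1`; the other terms must vanish. -/
theorem star_mul_eq_zero [PartialOrder A] [StarOrderedRing A] (h : IsCuntzFamily S) {i j : Fin n}
    (hij : i ≠ j) : star (S i) * S j = 0 := by
  have h1 : ∑ i, star (star (S i) * S j) * (star (S i) * S j) = 1 := by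
    calc _ = star (S j) * (∑ i, S i * star (S i)) * S j := by
          simp only [Finset.mul_sum, Finset.sum_mul, star_mul, star_star, mul_assoc]
      _ = 1 := by rw [h.sum_range, mul_one, h.isometry]
  rw [← Finset.add_sum_erase _ _ (Finset.mem_univ j), h.isometry, star_one, one_mul,
    add_eq_left, Finset.sum_eq_zero_iff_of_nonneg fun _ _ => star_mul_self_nonneg _] at h1
  exact CStarRing.star_mul_self_eq_zero_iff _ |>.1
    (h1 i (Finset.mem_erase.2 ⟨hij, Finset.mem_univ i⟩))

theorem star_word_mul_self (h : IsCuntzFamily S) (μ : List (Fin n)) :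
    star (cuntzWord S μ) * cuntzWord S μ = 1 := by
  induction μ with
  | nil => simp
  | cons i μ ih =>
    rw [cuntzWord_cons, star_mul, mul_assoc, ← mul_assoc (star (S i)), h.isometry, one_mul, ih]

theorem star_word_mul_eq_zero [PartialOrder A] [StarOrderedRing A] (h : IsCuntzFamily S)
    {μ ν : List (Fin n)} (hl : μ.length = ν.length) (hne : μ ≠ ν) :
    star (cuntzWord S μ) * cuntzWord S ν = 0 := by
  induction μ generalizing ν with
  | nil =>
    cases ν with
    | nil => exact absurd rfl hne
    | cons j ν => simp at hl
  | cons i μ ih =>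
    cases ν with
    | nil => simp at hl
    | cons j ν =>
      rw [cuntzWord_cons, cuntzWord_cons, star_mul, mul_assoc, ← mul_assoc (star (S i))]
      by_cases hij : i = j
      · subst hij
        rw [h.isometry, one_mul]
        exact ih (by simpa using hl) (by simpa using hne)
      · rw [h.star_mul_eq_zero hij, zero_mul, mul_zero]

theorem mul_mem_cuntzCore (S : Fin n → A) (i : Fin n) {a : A} (ha : a ∈ cuntzCore S) :
    S i * a ∈ cuntzCore S := by
  induction ha using Submodule.span_induction with
  | mem x hx =>
    obtain ⟨μ, ν, rfl⟩ := hx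
    rw [mul_cuntzMonomial]
    exact cuntzMonomial_mem_cuntzCore S _ _
  | zero => simp
  | add x y _ _ hx hy => rw [mul_add]; exact add_mem hx hy
  | smul c x _ hx => rw [mul_smul_comm]; exact Submodule.smul_mem _ _ hx

theorem star_mul_mem_cuntzCore [PartialOrder A] [StarOrderedRing A] (h : IsCuntzFamily S)
    (i : Fin n) {a : A} (ha : a ∈ cuntzCore S) : star (S i) * a ∈ cuntzCore S := by
  induction ha using Submodule.span_induction with
  | mem x hx =>
    obtain ⟨μ, ν, rfl⟩ := hx
    cases μ with
    | nil =>
      have : star (S i) * cuntzMonomial S [] ν = cuntzMonomial S [] (ν ++ [i]) := by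
        simp [cuntzMonomial, cuntzWord_append]
      rw [this]
      exact cuntzMonomial_mem_cuntzCore S _ _
    | cons j μ =>
      rw [← mul_cuntzMonomial, ← mul_assoc]
      by_cases hij : i = j
      · subst hij
        rw [h.isometry, one_mul]
        exact cuntzMonomial_mem_cuntzCore S _ _
      · rw [h.star_mul_eq_zero hij, zero_mul]
        exact zero_mem _
  | zero => simp
  | add x y _ _ hx hy => rw [mul_add]; exact add_mem hx hy
  | smul c x _ hx => rw [mul_smul_comm]; exact Submodule.smul_mem _ _ hx

/-- The core is a left module over the generated star algebra. The claim for `star a` is carried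
along so that the induction passes through products and stars. -/
theorem adjoin_mul_mem_cuntzCore [PartialOrder A] [StarOrderedRing A] (h : IsCuntzFamily S)
    {a : A} (ha : a ∈ StarAlgebra.adjoin ℂ (Set.range S)) :
    ∀ b ∈ cuntzCore S, a * b ∈ cuntzCore S ∧ star a * b ∈ cuntzCore S := by
  induction ha using StarAlgebra.adjoin_induction with
  | mem x hx =>
    obtain ⟨i, rfl⟩ := hx
    exact fun b hb => ⟨mul_mem_cuntzCore S i hb, h.star_mul_mem_cuntzCore i hb⟩
  | algebraMap r =>
    intro b hb
    rw [← algebraMap_star_comm, ← Algebra.smul_def, ← Algebra.smul_def]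
    exact ⟨Submodule.smul_mem _ _ hb, Submodule.smul_mem _ _ hb⟩
  | add x y _ _ hx hy =>
    intro b hb
    rw [star_add, add_mul, add_mul]
    exact ⟨add_mem (hx b hb).1 (hy b hb).1, add_mem (hx b hb).2 (hy b hb).2⟩
  | mul x y _ _ hx hy =>
    intro b hb
    rw [star_mul, mul_assoc, mul_assoc]
    exact ⟨(hx _ (hy b hb).1).1, (hy _ (hx b hb).2).2⟩
  | star x _ hx =>
    intro b hb
    rw [star_star]
    exact (hx b hb).symm

theorem adjoin_le_cuntzCore [PartialOrder A] [StarOrderedRing A] (h : IsCuntzFamily S)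
    {a : A} (ha : a ∈ StarAlgebra.adjoin ℂ (Set.range S)) : a ∈ cuntzCore S := by
  have h1 : (1 : A) ∈ cuntzCore S := by
    simpa [cuntzMonomial] using cuntzMonomial_mem_cuntzCore S [] []
  simpa using (h.adjoin_mul_mem_cuntzCore ha 1 h1).1

end IsCuntzFamily

theorem cuntzWord_mem_adjoin (S : Fin n → A) (μ : List (Fin n)) :
    cuntzWord S μ ∈ StarAlgebra.adjoin ℂ (Set.range S) := by
  induction μ with
  | nil => exact one_mem _
  | cons i μ ih =>
    rw [cuntzWord_cons]
    exact mul_mem (StarAlgebra.subset_adjoin ℂ _ ⟨i, rfl⟩) ih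

theorem cuntzCore_le_adjoin {a : A} (ha : a ∈ cuntzCore S) :
    a ∈ StarAlgebra.adjoin ℂ (Set.range S) := by
  induction ha using Submodule.span_induction with
  | mem x hx =>
    obtain ⟨μ, ν, rfl⟩ := hx
    exact mul_mem (cuntzWord_mem_adjoin S μ) (star_mem (cuntzWord_mem_adjoin S ν))
  | zero => exact zero_mem _
  | add x y _ _ hx hy => exact add_mem hx hy
  | smul c x _ hx => exact SMulMemClass.smul_mem c hx

theorem IsCuntzFamily.mem_cuntzCore_iff [PartialOrder A] [StarOrderedRing A]
    (h : IsCuntzFamily S) {a : A} :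
    a ∈ cuntzCore S ↔ a ∈ StarAlgebra.adjoin ℂ (Set.range S) :=
  ⟨cuntzCore_le_adjoin, h.adjoin_le_cuntzCore⟩

end Words

/-! ### The gauge action on monomials, the values of `τ ∘ Φ`, and the KMS condition. -/

namespace IsCuntzAlgebra

variable {n : ℕ} {A : Type*} [CStarAlgebra A] {S : Fin n → A}

theorem gauge_cuntzWord (h : IsCuntzAlgebra S) (z : Circle) (μ : List (Fin n)) :
    h.gauge z (cuntzWord S μ) = (z : ℂ) ^ μ.length • cuntzWord S μ := by
  induction μ with
  | nil => simp
  | cons i μ ih =>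
    rw [cuntzWord_cons, map_mul, ih, gauge_apply, smul_mul_smul_comm, List.length_cons, pow_succ']

theorem gauge_cuntzMonomial (h : IsCuntzAlgebra S) (z : Circle) (μ ν : List (Fin n)) :
    h.gauge z (cuntzMonomial S μ ν) =
      (z : ℂ) ^ ((μ.length : ℤ) - ν.length) • cuntzMonomial S μ ν := by
  rw [cuntzMonomial, map_mul, map_star, gauge_cuntzWord, gauge_cuntzWord, star_smul,
    smul_mul_smul_comm, star_pow, Complex.star_def, ← Circle.coe_inv_eq_conj, Circle.coe_inv,
    zpow_sub₀ (Circle.coe_ne_zero z), zpow_natCast, zpow_natCast, inv_pow, div_eq_mul_inv]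

theorem average_of_ne_zero (h : IsCuntzAlgebra S) {a : A} {k : ℤ} (hk : k ≠ 0)
    (ha : ∀ z : Circle, h.gauge z a = (z : ℂ) ^ k • a) : h.average a = 0 := by
  have hc : Complex.I * k ≠ 0 := mul_ne_zero Complex.I_ne_zero (Int.cast_ne_zero.2 hk)
  have he : ∀ θ : ℝ, h.gauge (Circle.exp θ) a = Complex.exp (Complex.I * k * θ) • a := by
    intro θ
    rw [ha, Circle.coe_exp, ← Complex.exp_int_mul]
    congr 2
    ring
  rw [average]
  simp only [he]
  rw [intervalIntegral.integral_smul_const, integral_exp_mul_complex hc]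
  have : Complex.exp (Complex.I * k * (2 * Real.pi : ℝ)) = 1 := by
    rw [Complex.exp_eq_one_iff]
    exact ⟨k, by push_cast; ring⟩
  rw [this]
  simp

theorem average_of_fixed (h : IsCuntzAlgebra S) {a : A} (ha : a ∈ h.fixedPoints) :
    h.average a = a := by
  have he : ∀ θ : ℝ, h.gauge (Circle.exp θ) a = a := fun θ => ha _
  rw [average]
  simp only [he]
  rw [intervalIntegral.integral_const, smul_smul, sub_zero,
    inv_mul_cancel₀ (by positivity), one_smul]

theorem cuntzMonomial_mem_fixedPoints (h : IsCuntzAlgebra S) {μ ν : List (Fin n)}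
    (hl : μ.length = ν.length) : cuntzMonomial S μ ν ∈ h.fixedPoints := by
  intro z
  rw [gauge_cuntzMonomial, hl, sub_self, zpow_zero, one_smul]

variable [PartialOrder A] [StarOrderedRing A]

theorem kmsState_of_ne_zero (h : IsCuntzAlgebra S) {τ : h.fixedPoints →ₗ[ℂ] ℂ}
    (hτ : h.IsFaithfulNormalizedTrace τ) {a : A} {k : ℤ} (hk : k ≠ 0)
    (ha : ∀ z : Circle, h.gauge z a = (z : ℂ) ^ k • a) : h.kmsState τ hτ a = 0 := by
  rw [kmsState_apply]
  have : h.expectation a = 0 := Subtype.ext (h.average_of_ne_zero hk ha)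
  rw [this, map_zero]

theorem kmsState_of_fixed (h : IsCuntzAlgebra S) {τ : h.fixedPoints →ₗ[ℂ] ℂ}
    (hτ : h.IsFaithfulNormalizedTrace τ) (a : h.fixedPoints) : h.kmsState τ hτ a = τ a := by
  rw [kmsState_apply]
  congr 1
  exact Subtype.ext (h.average_of_fixed a.2)

theorem kmsState_mul_comm_of_fixed (h : IsCuntzAlgebra S) {τ : h.fixedPoints →ₗ[ℂ] ℂ}
    (hτ : h.IsFaithfulNormalizedTrace τ) {a b : A} (ha : a ∈ h.fixedPoints)
    (hb : b ∈ h.fixedPoints) : h.kmsState τ hτ (a * b) = h.kmsState τ hτ (b * a) := by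
  lift a to h.fixedPoints using ha
  lift b to h.fixedPoints using hb
  have h1 := h.kmsState_of_fixed hτ (a * b)
  have h2 := h.kmsState_of_fixed hτ (b * a)
  rw [hτ.trace, ← h2] at h1
  exact h1

theorem kmsState_one (h : IsCuntzAlgebra S) {τ : h.fixedPoints →ₗ[ℂ] ℂ}
    (hτ : h.IsFaithfulNormalizedTrace τ) : h.kmsState τ hτ 1 = 1 := by
  have := h.kmsState_of_fixed hτ 1
  rwa [hτ.map_one] at this

/-- For different lengths the degree is nonzero and the average vanishes. For equal lengths the
projection `S_μ S_μ^*` fixes the monomial from the left; the trace property moves it to the right,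
where `S_ν^* S_μ = 0`. -/
theorem kmsState_cuntzMonomial_of_ne (h : IsCuntzAlgebra S) {τ : h.fixedPoints →ₗ[ℂ] ℂ}
    (hτ : h.IsFaithfulNormalizedTrace τ) {μ ν : List (Fin n)} (hne : μ ≠ ν) :
    h.kmsState τ hτ (cuntzMonomial S μ ν) = 0 := by
  by_cases hl : μ.length = ν.length
  · have h1 : cuntzMonomial S μ μ * cuntzMonomial S μ ν = cuntzMonomial S μ ν := by
      simp only [cuntzMonomial]
      rw [mul_assoc, ← mul_assoc (star _), h.family.star_word_mul_self, one_mul]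
    have h2 : cuntzMonomial S μ ν * cuntzMonomial S μ μ = 0 := by
      simp only [cuntzMonomial]
      rw [mul_assoc, ← mul_assoc (star _),
        h.family.star_word_mul_eq_zero hl.symm hne.symm, zero_mul, mul_zero]
    rw [← h1, h.kmsState_mul_comm_of_fixed hτ (h.cuntzMonomial_mem_fixedPoints rfl)
      (h.cuntzMonomial_mem_fixedPoints hl), h2, map_zero]
  · exact h.kmsState_of_ne_zero hτ (sub_ne_zero.2 (by exact_mod_cast hl))
      fun z => h.gauge_cuntzMonomial z μ ν

/-- For equal lengths `S_μ S_ν^*` is a partial isometry in `F` between the two projections, so the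
trace cannot distinguish them. -/
theorem kmsState_cuntzMonomial_congr (h : IsCuntzAlgebra S) {τ : h.fixedPoints →ₗ[ℂ] ℂ}
    (hτ : h.IsFaithfulNormalizedTrace τ) {μ ν : List (Fin n)} (hl : μ.length = ν.length) :
    h.kmsState τ hτ (cuntzMonomial S μ μ) = h.kmsState τ hτ (cuntzMonomial S ν ν) := by
  have key : ∀ μ ν : List (Fin n),
      cuntzMonomial S μ ν * cuntzMonomial S ν μ = cuntzMonomial S μ μ := by
    intro μ ν
    simp only [cuntzMonomial]
    rw [mul_assoc, ← mul_assoc (star _), h.family.star_word_mul_self, one_mul]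
  rw [← key μ ν, ← key ν μ]
  exact h.kmsState_mul_comm_of_fixed hτ (h.cuntzMonomial_mem_fixedPoints hl)
    (h.cuntzMonomial_mem_fixedPoints hl.symm)

theorem card_ne_zero (h : IsCuntzAlgebra S) {τ : h.fixedPoints →ₗ[ℂ] ℂ}
    (hτ : h.IsFaithfulNormalizedTrace τ) : (n : ℂ) ≠ 0 := by
  rw [Nat.cast_ne_zero]
  rintro rfl
  have h1 := h.family.sum_range
  have h2 := h.kmsState_one hτ
  rw [← h1] at h2
  simp at h2

theorem kmsState_cuntzMonomial_self (h : IsCuntzAlgebra S) {τ : h.fixedPoints →ₗ[ℂ] ℂ}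
    (hτ : h.IsFaithfulNormalizedTrace τ) (μ : List (Fin n)) :
    h.kmsState τ hτ (cuntzMonomial S μ μ) = (n : ℂ)⁻¹ ^ μ.length := by
  induction μ with
  | nil => simp [cuntzMonomial, h.kmsState_one hτ]
  | cons i μ ih =>
    -- Inserting `∑ S_j S_j^* = 1` splits the projection of `μ` into `n` projections of words one
    -- letter longer, all of equal trace; hence the factor `1 / n` per letter.
    have hsum : cuntzMonomial S μ μ = ∑ j, cuntzMonomial S (μ ++ [j]) (μ ++ [j]) := by
      calc cuntzMonomial S μ μ = cuntzWord S μ * (∑ j, S j * star (S j)) * star (cuntzWord S μ) := by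
            rw [h.family.sum_range, mul_one, cuntzMonomial]
        _ = _ := by
            simp [Finset.mul_sum, Finset.sum_mul, cuntzMonomial, cuntzWord_append, mul_assoc]
    rw [hsum, map_sum, Finset.sum_congr rfl fun j _ =>
      h.kmsState_cuntzMonomial_congr hτ (μ := μ ++ [j]) (ν := i :: μ) (by simp)] at ih
    rw [List.length_cons, pow_succ', ← ih]
    simp [inv_mul_cancel_left₀ (h.card_ne_zero hτ)]

/-- On monomials both sides vanish unless `b = S_ρ S_{iρ}^*`. In that case `S_i b` is the projection
of `iρ` and `b S_i` that of `ρ`, whose values differ by `1 / n`. -/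
theorem kmsState_generator_mul (h : IsCuntzAlgebra S) {τ : h.fixedPoints →ₗ[ℂ] ℂ}
    (hτ : h.IsFaithfulNormalizedTrace τ) (i : Fin n) {b : A} (hb : b ∈ cuntzCore S) :
    h.kmsState τ hτ (S i * b) = (n : ℂ)⁻¹ * h.kmsState τ hτ (b * S i) := by
  induction hb using Submodule.span_induction with
  | mem x hx =>
    obtain ⟨ρ, σ, rfl⟩ := hx
    rw [mul_cuntzMonomial]
    cases σ with
    | nil =>
      have : cuntzMonomial S ρ [] * S i = cuntzMonomial S (ρ ++ [i]) [] := by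
        simp [cuntzMonomial, cuntzWord_append]
      rw [this, h.kmsState_cuntzMonomial_of_ne hτ (by simp),
        h.kmsState_cuntzMonomial_of_ne hτ (by simp), mul_zero]
    | cons j σ =>
      have h1 : cuntzMonomial S ρ (j :: σ) * S i =
          cuntzWord S ρ * star (cuntzWord S σ) * (star (S j) * S i) := by
        simp [cuntzMonomial, mul_assoc]
      by_cases hij : j = i
      · subst hij
        rw [h1, h.family.isometry, mul_one]
        change _ = _ * h.kmsState τ hτ (cuntzMonomial S ρ σ)
        by_cases hρ : ρ = σ
        · subst hρ
          rw [h.kmsState_cuntzMonomial_self, h.kmsState_cuntzMonomial_self, List.length_cons,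
            pow_succ']
        · rw [h.kmsState_cuntzMonomial_of_ne hτ (by simpa using hρ),
            h.kmsState_cuntzMonomial_of_ne hτ hρ, mul_zero]
      · rw [h1, h.family.star_mul_eq_zero hij, mul_zero, map_zero, mul_zero,
          h.kmsState_cuntzMonomial_of_ne hτ]
        exact fun he => hij (List.cons.inj he.symm).1
  | zero => simp
  | add x y _ _ hx hy => rw [mul_add, add_mul, map_add, map_add, hx, hy, mul_add]
  | smul c x _ hx =>
    rw [mul_smul_comm, smul_mul_assoc, map_smul, map_smul, hx, smul_eq_mul, smul_eq_mul]
    ring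

theorem kmsState_word_mul (h : IsCuntzAlgebra S) {τ : h.fixedPoints →ₗ[ℂ] ℂ}
    (hτ : h.IsFaithfulNormalizedTrace τ) (μ : List (Fin n)) {b : A} (hb : b ∈ cuntzCore S) :
    h.kmsState τ hτ (cuntzWord S μ * b) =
      (n : ℂ)⁻¹ ^ μ.length * h.kmsState τ hτ (b * cuntzWord S μ) := by
  induction μ generalizing b with
  | nil => simp
  | cons i μ ih =>
    rw [h.family.mem_cuntzCore_iff] at hb
    rw [cuntzWord_cons, mul_assoc, h.kmsState_generator_mul hτ i
      (h.family.mem_cuntzCore_iff.2 (mul_mem (cuntzWord_mem_adjoin S μ) hb)), mul_assoc, ih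
      (h.family.mem_cuntzCore_iff.2 (mul_mem hb (StarAlgebra.subset_adjoin ℂ _ ⟨i, rfl⟩))),
      List.length_cons, pow_succ', mul_assoc, mul_assoc]

/-- This is the adjoint of the relation for words: the state commutes with the star, and the factor
`n ^ (-|μ|)` is real and invertible. -/
theorem kmsState_star_word_mul (h : IsCuntzAlgebra S) {τ : h.fixedPoints →ₗ[ℂ] ℂ}
    (hτ : h.IsFaithfulNormalizedTrace τ) (μ : List (Fin n)) {b : A} (hb : b ∈ cuntzCore S) :
    h.kmsState τ hτ (star (cuntzWord S μ) * b) =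
      (n : ℂ) ^ μ.length * h.kmsState τ hτ (b * star (cuntzWord S μ)) := by
  have h1 := congrArg star (h.kmsState_word_mul hτ μ (star_mem_cuntzCore S hb))
  rw [← map_star, star_mul', ← map_star, star_mul, star_mul, star_star] at h1
  rw [h1, star_pow, star_inv₀, star_natCast, ← mul_assoc, ← mul_pow,
    mul_inv_cancel₀ (h.card_ne_zero hτ), one_pow, one_mul]

/-- The KMS condition for `τ ∘ Φ` on monomials. -/
theorem kmsState_cuntzMonomial_mul (h : IsCuntzAlgebra S) {τ : h.fixedPoints →ₗ[ℂ] ℂ}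
    (hτ : h.IsFaithfulNormalizedTrace τ) (μ ν : List (Fin n)) {b : A} (hb : b ∈ cuntzCore S) :
    h.kmsState τ hτ (cuntzMonomial S μ ν * b) =
      (n : ℂ) ^ ((ν.length : ℤ) - μ.length) * h.kmsState τ hτ (b * cuntzMonomial S μ ν) := by
  rw [h.family.mem_cuntzCore_iff] at hb
  have hμ := cuntzWord_mem_adjoin S μ
  have hν := star_mem (cuntzWord_mem_adjoin S ν)
  rw [cuntzMonomial, mul_assoc, h.kmsState_word_mul hτ μ
    (h.family.mem_cuntzCore_iff.2 (mul_mem hν hb)), mul_assoc, h.kmsState_star_word_mul hτ ν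
    (h.family.mem_cuntzCore_iff.2 (mul_mem hb hμ)), zpow_sub₀ (h.card_ne_zero hτ), zpow_natCast,
    zpow_natCast, mul_assoc, div_eq_mul_inv, inv_pow]
  ring

end IsCuntzAlgebra

/-! ## Antilinear operators with polar decomposition `J Q`, with `Q` diagonal -/

/-- A map of a total family that reverses inner products extends to an antilinear isometry. -/
theorem exists_antilinear_isometry {κ H : Type*} [NormedAddCommGroup H] [InnerProductSpace ℂ H]
    [CompleteSpace H] {e f : κ → H} (hef : ∀ a b, ⟪f a, f b⟫_ℂ = ⟪e b, e a⟫_ℂ)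
    (he : (Submodule.span ℂ (Set.range e)).topologicalClosure = ⊤) :
    ∃ J : H →ₛₗᵢ[starRingEnd ℂ] H, ∀ a, J (e a) = f a := by
  let p : (κ →₀ ℂ) →ₗ[ℂ] H := Finsupp.linearCombination ℂ e
  let q : (κ →₀ ℂ) →ₛₗ[starRingEnd ℂ] H :=
    -- Coefficients are conjugated first, so that `q` is antilinear. Reversal of inner products
    -- gives `‖q c‖ = ‖p c‖`, so `q` factors through `p` and extends by density.
    (Finsupp.linearCombination ℂ f).comp
      (Finsupp.mapRange.linearMap (starLinearEquiv ℂ (A := ℂ)).toLinearMap)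
  have hp : ∀ a c, p (Finsupp.single a c) = c • e a := fun a c => by simp [p]
  have hq : ∀ a c, q (Finsupp.single a c) = conj c • f a := fun a c => by simp [q]
  have hinner : ∀ c d, ⟪q c, q d⟫_ℂ = ⟪p d, p c⟫_ℂ := by
    intro c d
    induction c using Finsupp.induction_linear with
    | zero => simp
    | add x y hx hy => rw [map_add, map_add, inner_add_left, inner_add_right, hx, hy]
    | single a r =>
      induction d using Finsupp.induction_linear with
      | zero => simp
      | add x y hx hy => rw [map_add, map_add, inner_add_left, inner_add_right, hx, hy]
      | single b s =>
        simp only [hp, hq, inner_smul_left, inner_smul_right, hef, Complex.conj_conj]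
        ring
  have hnorm : ∀ c, ‖q c‖ = ‖p c‖ := fun c => by
    rw [@norm_eq_sqrt_re_inner ℂ, hinner, ← @norm_eq_sqrt_re_inner ℂ]
  have hd : DenseRange p := by
    have : (Set.range p) = (Submodule.span ℂ (Set.range e) : Set H) := by
      rw [← Finsupp.range_linearCombination]; rfl
    rw [DenseRange, this, Submodule.dense_iff_topologicalClosure_eq_top, he]
  have hext : ∀ c, q.extendOfNorm p (p c) = q c :=
    LinearMap.extendOfNorm_eq hd ⟨1, fun c => by rw [hnorm, one_mul]⟩
  refine ⟨⟨(q.extendOfNorm p).toLinearMap, fun x => ?_⟩, fun a => ?_⟩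
  · refine hd.induction_on (p := fun x => ‖q.extendOfNorm p x‖ = ‖x‖) x
      (isClosed_eq (by fun_prop) (by fun_prop)) fun c => ?_
    rw [hext, hnorm]
  · change q.extendOfNorm p (e a) = f a
    have := hext (Finsupp.single a 1)
    simpa [hp, hq] using this

/-- Antilinear isometries reverse inner products. -/
theorem LinearIsometry.inner_map_map_conj {H : Type*} [NormedAddCommGroup H]
    [InnerProductSpace ℂ H] (J : H →ₛₗᵢ[starRingEnd ℂ] H) (x y : H) :
    ⟪J x, J y⟫_ℂ = ⟪y, x⟫_ℂ := by
  have key : ∀ x y, (⟪J x, J y⟫_ℂ).re = (⟪y, x⟫_ℂ).re := by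
    intro x y
    have h1 := @norm_add_sq ℂ _ _ _ _ (J x) (J y)
    have h2 := @norm_add_sq ℂ _ _ _ _ y x
    rw [← map_add, J.norm_map, J.norm_map, J.norm_map, add_comm x y] at h1
    change _ = _ + 2 * (⟪J x, J y⟫_ℂ).re + _ at h1
    change _ = _ + 2 * (⟪y, x⟫_ℂ).re + _ at h2
    linarith
  -- The real part comes from polarization; the imaginary part follows on replacing `x` by `i x`, by
  -- antilinearity.
  refine Complex.ext (key x y) ?_
  have h3 := key (Complex.I • x) y
  rw [J.map_smulₛₗ, inner_smul_left, inner_smul_right] at h3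
  simpa using h3

namespace AntilinearRel

variable {H : Type*} [NormedAddCommGroup H] [InnerProductSpace ℂ H]

theorem mem_comp_graph {G K : AntilinearRel H} (hG : G.IsFunctional) (hK : K.IsFunctional)
    {p : H × H} : p ∈ (AntilinearOperator.comp K.toOperator G.toOperator).graph ↔
      ∃ η, (p.1, η) ∈ G.graph ∧ (η, p.2) ∈ K.graph := by
  rw [LinearPMap.mem_graph_iff]
  constructor
  · rintro ⟨y, hy, hp⟩
    obtain ⟨h₁, h₂⟩ := y.2
    refine ⟨G.toOperator ⟨y, h₁⟩, ?_, ?_⟩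
    · rw [← hy]; exact toOperator_apply hG ⟨y, h₁⟩
    · rw [← hp]; exact toOperator_apply hK ⟨_, h₂⟩
  · rintro ⟨η, h₁, h₂⟩
    have hd : p.1 ∈ G.toOperator.domain := ⟨η, h₁⟩
    have he : G.toOperator ⟨p.1, hd⟩ = η := hG.eq (toOperator_apply hG ⟨p.1, hd⟩) h₁
    have hd' : G.toOperator ⟨p.1, hd⟩ ∈ K.toOperator.domain := by rw [he]; exact ⟨p.2, h₂⟩
    refine ⟨⟨p.1, hd, hd'⟩, rfl, hK.eq (toOperator_apply hK ⟨_, hd'⟩) ?_⟩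
    change (G.toOperator ⟨p.1, hd⟩, p.2) ∈ K.graph
    rwa [he]

variable {ι : Type*} {P : ι → H →L[ℂ] H} {f : ι → ℝ} {J : H →ₛₗᵢ[starRingEnd ℂ] H}
  {G : AntilinearRel H}

/-- Here `hG` encodes `T = J Q` at the level of graphs: `(ξ, η)` belongs to `G` exactly when `J η =
Q ξ`. Thus `ξ = 0` forces `J η = 0`, and `J` is injective. -/
theorem isFunctional_of_polar (hP : IsOrthogonalDecomposition P)
    (hG : ∀ p, p ∈ G.graph ↔ (p.1, J p.2) ∈ (diagonalOperator P fun i => (f i : ℂ)).graph) :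
    G.IsFunctional := by
  intro η hη
  rw [hG, hP.mem_diagonalOperator_graph] at hη
  have : J η = 0 := hP.ext fun i => by simpa using hη i
  rw [← norm_eq_zero, ← J.norm_map, this, norm_zero]

/-- The adjoint of `J Q` is `Q J`. It suffices to test on the vectors `P i x`, which always lie in
the domain and determine every coordinate. -/
theorem mem_adjointRel_of_polar (hP : IsOrthogonalDecomposition P) (hJ : ∀ ξ, J (J ξ) = ξ)
    (hG : ∀ p, p ∈ G.graph ↔ (p.1, J p.2) ∈ (diagonalOperator P fun i => (f i : ℂ)).graph)
    {p : H × H} : p ∈ (AntilinearOperator.adjointRel G.toOperator).graph ↔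
      (J p.1, p.2) ∈ (diagonalOperator P fun i => (f i : ℂ)).graph := by
  have hf := isFunctional_of_polar hP hG
  change (∀ ξ : G.toOperator.domain, ⟪G.toOperator ξ, p.1⟫_ℂ = ⟪p.2, (ξ : H)⟫_ℂ) ↔ _
  rw [hP.mem_diagonalOperator_graph]
  constructor
  · intro h i
    refine ext_inner_right ℂ fun x => ?_
    have hx : (P i x, J ((f i : ℂ) • P i x)) ∈ G.graph := by
      rw [hG, hP.mem_diagonalOperator_graph]
      intro j
      change P j (J (J _)) = _
      rw [hJ]
      by_cases hij : j = i
      · subst hij; rw [map_smul]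
      · simp [hP.ortho j i hij]
    have h1 := h ⟨P i x, _, hx⟩
    rw [hf.eq (toOperator_apply hf _) hx] at h1
    change ⟪J ((f i : ℂ) • P i x), p.1⟫_ℂ = ⟪p.2, P i x⟫_ℂ at h1
    rw [← hJ p.1, J.inner_map_map_conj, inner_smul_right] at h1
    rw [hP.symm, inner_smul_left, hP.symm, ← h1, Complex.conj_ofReal]
  · intro h ξ
    have h1 := (hG _).1 (toOperator_apply hf ξ)
    rw [hP.mem_diagonalOperator_graph] at h1
    nth_rw 1 [← hJ p.1]
    rw [← hJ (G.toOperator ξ), J.inner_map_map_conj]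
    refine hP.inner_ext fun i => ?_
    rw [h1, ← hP.symm, h, inner_smul_right, inner_smul_left, hP.symm, Complex.conj_ofReal]

/-- If `T = J Q` with `J` an antiunitary involution and `Q` a real diagonal operator, then
`T^* T = Q²`. -/
theorem adjoint_comp_self_of_polar [CompleteSpace H] (hP : IsOrthogonalDecomposition P)
    (hJ : ∀ ξ, J (J ξ) = ξ)
    (hG : ∀ p, p ∈ G.graph ↔ (p.1, J p.2) ∈ (diagonalOperator P fun i => (f i : ℂ)).graph) :
    AntilinearOperator.comp (AntilinearOperator.adjoint G.toOperator) G.toOperator =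
      diagonalOperator P fun i => ((f i ^ 2 : ℝ) : ℂ) := by
  have hf := isFunctional_of_polar hP hG
  have hadj : (AntilinearOperator.adjointRel G.toOperator).IsFunctional := by
    intro η hη
    rw [mem_adjointRel_of_polar hP hJ hG, hP.mem_diagonalOperator_graph] at hη
    exact hP.ext fun i => by simpa using hη i
  refine LinearPMap.eq_of_eq_graph (SetLike.ext fun p => ?_)
  rw [AntilinearOperator.adjoint, mem_comp_graph hf hadj, hP.mem_diagonalOperator_graph]
  simp only [hG, mem_adjointRel_of_polar hP hJ hG, hP.mem_diagonalOperator_graph]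
  constructor
  · rintro ⟨η, h₁, h₂⟩ i
    rw [h₂, h₁, smul_smul, sq, Complex.ofReal_mul]
  · intro h
    -- The domain of `Q²` lies in that of `Q`: coordinatewise this is the bound `a² ≤ 1 + a⁴`, and
    -- `∑ f i ^ 4 ‖P i p.1‖ ^ 2` is the norm square of `p.2`.
    have hd : p.1 ∈ (diagonalOperator P fun i => (f i : ℂ)).domain := by
      rw [hP.mem_diagonalOperator_domain]
      refine ((hP.hasSum_norm_sq p.1).summable.add
        (hP.hasSum_norm_sq p.2).summable).of_nonneg_of_le (fun i => by positivity) fun i => ?_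
      rw [h, norm_smul, mul_pow, ← one_add_mul]
      refine mul_le_mul_of_nonneg_right ?_ (by positivity)
      rw [Complex.norm_real, Complex.norm_real, norm_pow]
      nlinarith [sq_nonneg (‖f i‖ ^ 2 - 1), sq_nonneg (‖f i‖ ^ 2)]
    refine ⟨J (diagonalOperator P _ ⟨p.1, hd⟩), fun i => ?_, fun i => ?_⟩
    · rw [hJ, hP.apply_diagonalOperator]
    · rw [hJ, hP.apply_diagonalOperator, h, smul_smul, sq, Complex.ofReal_mul]

theorem mem_domain_of_polar (hJ : ∀ ξ, J (J ξ) = ξ)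
    (hG : ∀ p, p ∈ G.graph ↔ (p.1, J p.2) ∈ (diagonalOperator P fun i => (f i : ℂ)).graph) (ξ : H) :
    ξ ∈ G.toOperator.domain ↔ ξ ∈ (diagonalOperator P fun i => (f i : ℂ)).domain := by
  constructor
  · rintro ⟨η, hη⟩
    exact LinearPMap.mem_domain_of_mem_graph ((hG _).1 hη)
  · intro h
    refine ⟨J (diagonalOperator P _ ⟨ξ, h⟩), (hG _).2 ?_⟩
    change (ξ, J (J _)) ∈ _
    rw [hJ]
    exact LinearPMap.mem_graph _ ⟨ξ, h⟩

theorem toOperator_eq_of_polar (hP : IsOrthogonalDecomposition P) (hJ : ∀ ξ, J (J ξ) = ξ)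
    (hG : ∀ p, p ∈ G.graph ↔ (p.1, J p.2) ∈ (diagonalOperator P fun i => (f i : ℂ)).graph)
    (ξ : G.toOperator.domain) (η : (diagonalOperator P fun i => (f i : ℂ)).domain)
    (h : (ξ : H) = η) : G.toOperator ξ = J (diagonalOperator P (fun i => (f i : ℂ)) η) := by
  have hf := isFunctional_of_polar hP hG
  refine hf.eq (toOperator_apply hf ξ) ((hG _).2 ?_)
  change ((ξ : H), J (J _)) ∈ _
  rw [hJ, h]
  exact LinearPMap.mem_graph _ η

end AntilinearRel

/-! ## The grading of the GNS space of the KMS state -/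

section GNS

variable {A : Type*} [CStarAlgebra A] [PartialOrder A] [StarOrderedRing A] (ω : A →ₚ[ℂ] ℂ)

theorem gnsStarAlgHom_gnsVector (a b : A) :
    ω.gnsStarAlgHom a (gnsVector ω b) = gnsVector ω (a * b) := by
  simp [gnsVector]

/-- The map is the orbit of the cyclic vector of `1` under a contractive representation. -/
theorem continuous_gnsVector : Continuous (gnsVector ω) := by
  have h1 : ∀ a, gnsVector ω a = ω.gnsStarAlgHom a (gnsVector ω 1) := fun a => by
    rw [gnsStarAlgHom_gnsVector, mul_one]
  have h2 : Continuous ω.gnsStarAlgHom :=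
    AddMonoidHomClass.continuous_of_bound ω.gnsStarAlgHom 1 fun a => by
      simpa using NonUnitalStarAlgHom.norm_apply_le ω.gnsStarAlgHom a
  rw [funext h1]
  exact h2.clm_apply continuous_const

theorem denseRange_gnsVector : DenseRange (gnsVector ω) :=
  UniformSpace.Completion.denseRange_coe.comp ω.toPreGNS.surjective.denseRange
    (UniformSpace.Completion.continuous_coe _)

/-- `gnsVector` as a linear map. -/
def gnsVectorLinear : A →ₗ[ℂ] ω.GNS where
  toFun := gnsVector ω
  map_add' := gnsVector_add ω
  map_smul' := gnsVector_smul ω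

theorem gnsVector_zero : gnsVector ω 0 = 0 :=
  map_zero (gnsVectorLinear ω)

end GNS

namespace IsCuntzAlgebra

variable {n : ℕ} {A : Type*} [CStarAlgebra A] {S : Fin n → A}

theorem dense_cuntzCore [PartialOrder A] [StarOrderedRing A] (h : IsCuntzAlgebra S) : Dense (cuntzCore S : Set A) := by
  have h1 : (cuntzCore S : Set A) = (StarAlgebra.adjoin ℂ (Set.range S) : Set A) :=
    Set.ext fun a => h.family.mem_cuntzCore_iff
  rw [h1, dense_iff_closure_eq, ← StarSubalgebra.topologicalClosure_coe, h.generates]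
  rfl

theorem gauge_one (h : IsCuntzAlgebra S) (a : A) : h.gauge 1 a = a := by
  have : h.gauge 1 = StarAlgHom.id ℂ A := h.hom_ext fun i => by simp [gauge_apply]
  rw [this]
  rfl

end IsCuntzAlgebra

/-- The vectors `S_μ S_ν^*` with `|μ| - |ν| = k`. -/
def homogeneousVectors {n : ℕ} {A : Type*} [CStarAlgebra A] [PartialOrder A] [StarOrderedRing A]
    (S : Fin n → A) (ω : A →ₚ[ℂ] ℂ) (k : ℤ) : Set ω.GNS :=
  {v | ∃ μ ν : List (Fin n), (μ.length : ℤ) - ν.length = k ∧ v = gnsVector ω (cuntzMonomial S μ ν)}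

/-- The projection of the GNS space onto the closed span of the vectors of degree `k`. -/
def degreeProjection {n : ℕ} {A : Type*} [CStarAlgebra A] [PartialOrder A] [StarOrderedRing A]
    (S : Fin n → A) (ω : A →ₚ[ℂ] ℂ) (k : ℤ) : ω.GNS →L[ℂ] ω.GNS :=
  (Submodule.span ℂ (homogeneousVectors S ω k)).topologicalClosure.starProjection

section Grading

variable {n : ℕ} {A : Type*} [CStarAlgebra A] [PartialOrder A] [StarOrderedRing A] {S : Fin n → A}
  (hS : IsCuntzAlgebra S) {τ : hS.fixedPoints →ₗ[ℂ] ℂ} (hτ : hS.IsFaithfulNormalizedTrace τ)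

theorem degreeProjection_of_mem (ω : A →ₚ[ℂ] ℂ) (k : ℤ) {x : ω.GNS}
    (hx : x ∈ homogeneousVectors S ω k) : degreeProjection S ω k x = x :=
  Submodule.starProjection_eq_self_iff.2
    (Submodule.le_topologicalClosure _ (Submodule.subset_span hx))

theorem degreeProjection_mem (ω : A →ₚ[ℂ] ℂ) (k : ℤ) (x : ω.GNS) :
    degreeProjection S ω k x ∈
      (Submodule.span ℂ (homogeneousVectors S ω k)).topologicalClosure :=
  Submodule.starProjection_apply_mem _ _

namespace IsCuntzAlgebra

theorem topologicalClosure_span_gnsVector (h : IsCuntzAlgebra S) (ω : A →ₚ[ℂ] ℂ) :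
    (Submodule.span ℂ (Set.range fun p : List (Fin n) × List (Fin n) =>
      gnsVector ω (cuntzMonomial S p.1 p.2))).topologicalClosure = ⊤ := by
  have h1 : gnsVector ω '' (cuntzCore S : Set A) ⊆
      (Submodule.span ℂ (Set.range fun p : List (Fin n) × List (Fin n) =>
        gnsVector ω (cuntzMonomial S p.1 p.2)) : Set ω.GNS) := by
    rintro _ ⟨a, ha, rfl⟩
    have : (cuntzCore S).map (gnsVectorLinear ω) ≤ Submodule.span ℂ
        (Set.range fun p : List (Fin n) × List (Fin n) =>
          gnsVector ω (cuntzMonomial S p.1 p.2)) := by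
      rw [cuntzCore, Submodule.map_span]
      refine Submodule.span_mono ?_
      rintro _ ⟨_, ⟨μ, ν, rfl⟩, rfl⟩
      exact ⟨(μ, ν), rfl⟩
    exact this ⟨a, ha, rfl⟩
  rw [← Submodule.dense_iff_topologicalClosure_eq_top]
  exact ((denseRange_gnsVector ω).dense_image (continuous_gnsVector ω) h.dense_cuntzCore).mono h1

theorem inner_gnsVector_of_ne {μ ν ρ σ : List (Fin n)}
    (hne : (μ.length : ℤ) - ν.length ≠ (ρ.length : ℤ) - σ.length) :
    ⟪gnsVector (hS.kmsState τ hτ) (cuntzMonomial S μ ν),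
      gnsVector (hS.kmsState τ hτ) (cuntzMonomial S ρ σ)⟫_ℂ = 0 := by
  rw [inner_gnsVector]
  refine hS.kmsState_of_ne_zero hτ (sub_ne_zero.2 hne.symm) fun z => ?_
  rw [star_cuntzMonomial, map_mul, gauge_cuntzMonomial, gauge_cuntzMonomial, smul_mul_smul_comm,
    ← zpow_add₀ (Circle.coe_ne_zero z)]
  congr 2
  ring

theorem isOrthogonalDecomposition_degreeProjection :
    IsOrthogonalDecomposition (degreeProjection S (hS.kmsState τ hτ)) := by
  refine IsHilbertSum.isOrthogonalDecomposition (V := fun k =>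
    (Submodule.span ℂ (homogeneousVectors S (hS.kmsState τ hτ) k)).topologicalClosure)
    (IsHilbertSum.mkInternal _ ?_ ?_)
  · refine OrthogonalFamily.of_pairwise fun k l hkl => ?_
    refine Submodule.isOrtho_iff_le.2 ?_
    refine Submodule.topologicalClosure_minimal _ ?_ (Submodule.isClosed_orthogonal _)
    rw [Submodule.orthogonal_closure]
    refine Submodule.isOrtho_span.2 ?_
    rintro _ ⟨μ, ν, rfl, rfl⟩ _ ⟨ρ, σ, rfl, rfl⟩
    exact inner_gnsVector_of_ne hS hτ hkl
  · rw [← hS.topologicalClosure_span_gnsVector (hS.kmsState τ hτ)]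
    refine Submodule.topologicalClosure_mono (Submodule.span_le.2 ?_)
    rintro _ ⟨⟨μ, ν⟩, rfl⟩
    exact Submodule.mem_iSup_of_mem ((μ.length : ℤ) - ν.length)
      (Submodule.le_topologicalClosure _ (Submodule.subset_span ⟨μ, ν, rfl, rfl⟩))

/-- The monomials span a core for every diagonal operator. This identifies operators defined as
closures on `O_{nc}` with maximal diagonal ones. -/
theorem diagonalOperator_degreeProjection_graph (f : ℤ → ℂ) :
    (diagonalOperator (degreeProjection S (hS.kmsState τ hτ)) f).graph =
      (Submodule.span ℂ {p | ∃ μ ν : List (Fin n),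
        p = (gnsVector (hS.kmsState τ hτ) (cuntzMonomial S μ ν),
          f ((μ.length : ℤ) - ν.length) • gnsVector (hS.kmsState τ hτ) (cuntzMonomial S μ ν))
        }).topologicalClosure := by
  rw [(isOrthogonalDecomposition_degreeProjection hS hτ).diagonalOperator_graph_eq
    (X := homogeneousVectors S (hS.kmsState τ hτ)) (fun k x hx => degreeProjection_of_mem _ k hx)
    (fun k x => degreeProjection_mem _ k x)]
  congr 2
  ext p
  constructor
  · rintro ⟨_, _, ⟨μ, ν, rfl, rfl⟩, rfl⟩
    exact ⟨μ, ν, rfl⟩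
  · rintro ⟨μ, ν, rfl⟩
    exact ⟨_, _, ⟨μ, ν, rfl, rfl⟩, rfl⟩

theorem gaugeGenerator_eq :
    gaugeGenerator S (hS.kmsState τ hτ) =
      diagonalOperator (degreeProjection S (hS.kmsState τ hτ)) fun k => ((k : ℝ) : ℂ) := by
  refine LinearPMap.eq_of_eq_graph ?_
  have h := diagonalOperator_degreeProjection_graph hS hτ fun k => ((k : ℝ) : ℂ)
  simp only [Int.cast_sub, Int.cast_natCast, Complex.ofReal_sub, Complex.ofReal_natCast] at h
  rw [gaugeGenerator, ← h]
  exact Submodule.toLinearPMap_graph_eq _ fun p hp hp0 =>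
    LinearPMap.graph_fst_eq_zero_snd _ hp hp0

theorem diagonalOperator_gnsVector (f : ℤ → ℂ) (μ ν : List (Fin n)) :
    (gnsVector (hS.kmsState τ hτ) (cuntzMonomial S μ ν),
      f ((μ.length : ℤ) - ν.length) • gnsVector (hS.kmsState τ hτ) (cuntzMonomial S μ ν)) ∈
      (diagonalOperator (degreeProjection S (hS.kmsState τ hτ)) f).graph := by
  rw [diagonalOperator_degreeProjection_graph]
  exact Submodule.le_topologicalClosure _ (Submodule.subset_span ⟨μ, ν, rfl⟩)

/-- The unitary implementing `γ_z` on the GNS space. -/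
def gaugeUnitary (z : Circle) : (hS.kmsState τ hτ).GNS →L[ℂ] (hS.kmsState τ hτ).GNS :=
  (isOrthogonalDecomposition_degreeProjection hS hτ).contraction (fun k => (z : ℂ) ^ k)
    fun k => by rw [norm_zpow, Circle.norm_coe, one_zpow]

theorem everywhereDefined_gaugeUnitary (z : Circle) :
    everywhereDefined (gaugeUnitary hS hτ z) =
      diagonalOperator (degreeProjection S (hS.kmsState τ hτ)) fun k => (z : ℂ) ^ k :=
  IsOrthogonalDecomposition.everywhereDefined_contraction _ _

theorem gaugeUnitary_gnsVector (z : Circle) (a : A) :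
    gaugeUnitary hS hτ z (gnsVector (hS.kmsState τ hτ) a) =
      gnsVector (hS.kmsState τ hτ) (hS.gauge z a) := by
  have hc : Continuous (hS.gauge z) := continuous_hom _
  refine hS.dense_cuntzCore.induction (P := fun a => gaugeUnitary hS hτ z
    (gnsVector (hS.kmsState τ hτ) a) = gnsVector (hS.kmsState τ hτ) (hS.gauge z a))
    (fun a ha => ?_) (isClosed_eq
      ((gaugeUnitary hS hτ z).continuous.comp (continuous_gnsVector _))
      ((continuous_gnsVector _).comp hc)) a
  induction ha using Submodule.span_induction with
  | mem x hx =>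
    obtain ⟨μ, ν, rfl⟩ := hx
    have h := diagonalOperator_gnsVector hS hτ (fun k => (z : ℂ) ^ k) μ ν
    rw [← everywhereDefined_gaugeUnitary, LinearPMap.mem_graph_iff] at h
    obtain ⟨y, hy, h⟩ := h
    change gaugeUnitary hS hτ z (y : (hS.kmsState τ hτ).GNS) = _ at h
    rw [hy] at h
    rw [gauge_cuntzMonomial, gnsVector_smul]
    exact h
  | zero => rw [map_zero, gnsVector_zero, map_zero]
  | add x y _ _ hx hy => rw [gnsVector_add, map_add, map_add, gnsVector_add, hx, hy]
  | smul c x _ hx => rw [gnsVector_smul, map_smul, map_smul, gnsVector_smul, hx]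

/-- On the dense set of vectors `b ∈ A` this is the identity `γ_z (a γ_{z⁻¹} (b)) = γ_z (a) b`. -/
theorem gaugeUnitary_conj (z : Circle) (a : A) :
    gaugeUnitary hS hτ z * (hS.kmsState τ hτ).gnsStarAlgHom a * gaugeUnitary hS hτ z⁻¹ =
      (hS.kmsState τ hτ).gnsStarAlgHom (hS.gauge z a) := by
  refine ContinuousLinearMap.ext fun ξ => ?_
  refine (denseRange_gnsVector (hS.kmsState τ hτ)).induction_on
    (p := fun ξ => (gaugeUnitary hS hτ z * (hS.kmsState τ hτ).gnsStarAlgHom a *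
      gaugeUnitary hS hτ z⁻¹) ξ = (hS.kmsState τ hτ).gnsStarAlgHom (hS.gauge z a) ξ) ξ
    (isClosed_eq (ContinuousLinearMap.continuous _) (ContinuousLinearMap.continuous _)) fun b => ?_
  rw [mul_apply_eq_comp, mul_apply_eq_comp, gaugeUnitary_gnsVector, gnsStarAlgHom_gnsVector,
    gaugeUnitary_gnsVector, gnsStarAlgHom_gnsVector, map_mul, gauge_mul, mul_inv_cancel, gauge_one]

/-! ## The Tomita operator -/

theorem exists_modular_conjugation :
    ∃ J : (hS.kmsState τ hτ).GNS →ₛₗᵢ[starRingEnd ℂ] (hS.kmsState τ hτ).GNS,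
      (∀ ξ, J (J ξ) = ξ) ∧ ∀ μ ν : List (Fin n),
        J (gnsVector (hS.kmsState τ hτ) (cuntzMonomial S μ ν)) =
          ((√((n : ℝ) ^ ((μ.length : ℤ) - ν.length)) : ℝ) : ℂ) •
            gnsVector (hS.kmsState τ hτ) (cuntzMonomial S ν μ) := by
  have hn : (n : ℝ) ≠ 0 := by exact_mod_cast hS.card_ne_zero hτ
  obtain ⟨J, hJ⟩ := exists_antilinear_isometry
    (e := fun p : List (Fin n) × List (Fin n) =>
      gnsVector (hS.kmsState τ hτ) (cuntzMonomial S p.1 p.2))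
    (f := fun p : List (Fin n) × List (Fin n) =>
      ((√((n : ℝ) ^ ((p.1.length : ℤ) - p.2.length)) : ℝ) : ℂ) •
        gnsVector (hS.kmsState τ hτ) (cuntzMonomial S p.2 p.1)) (by
    rintro ⟨μ, ν⟩ ⟨ρ, σ⟩
    by_cases hd : (μ.length : ℤ) - ν.length = (ρ.length : ℤ) - σ.length
    -- In equal degree `d` the two square roots contribute `n ^ d`, while exchanging the factors by
    -- the KMS relation contributes `n ^ (-d)`.
    · have h := hS.kmsState_cuntzMonomial_mul hτ μ ν (cuntzMonomial_mem_cuntzCore S σ ρ)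
      simp only [inner_smul_left, inner_smul_right, inner_gnsVector, star_cuntzMonomial,
        Complex.conj_ofReal]
      rw [h, ← hd, ← mul_assoc, ← mul_assoc, ← Complex.ofReal_mul,
        Real.mul_self_sqrt (by positivity), Complex.ofReal_zpow, Complex.ofReal_natCast,
        ← zpow_add₀ (hS.card_ne_zero hτ)]
      simp
    · simp only [inner_smul_left, inner_smul_right]
      rw [inner_gnsVector_of_ne hS hτ (by omega), inner_gnsVector_of_ne hS hτ (Ne.symm hd)]
      simp) (hS.topologicalClosure_span_gnsVector _)
  refine ⟨J, fun ξ => ?_, fun μ ν => hJ (μ, ν)⟩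
  have hcl : IsClosed {ξ | J (J ξ) = ξ} :=
    isClosed_eq (J.continuous.comp J.continuous) continuous_id
  have hξ : ξ ∈ (Submodule.span ℂ (Set.range fun p : List (Fin n) × List (Fin n) =>
      gnsVector (hS.kmsState τ hτ) (cuntzMonomial S p.1 p.2))).topologicalClosure := by
    rw [hS.topologicalClosure_span_gnsVector]; trivial
  refine closure_minimal (fun η hη => ?_) hcl hξ
  induction hη using Submodule.span_induction with
  | mem x hx =>
    obtain ⟨⟨μ, ν⟩, rfl⟩ := hx
    change J (J _) = _
    rw [hJ, J.map_smulₛₗ, hJ (ν, μ), Complex.conj_ofReal, smul_smul, ← Complex.ofReal_mul,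
      ← Real.sqrt_mul (by positivity), ← zpow_add₀ hn]
    simp
  | zero => simp
  | add x y _ _ hx hy =>
    simp only [Set.mem_ofPred_eq] at *
    rw [map_add, map_add, hx, hy]
  | smul c x _ hx =>
    simp only [Set.mem_ofPred_eq] at *
    rw [J.map_smulₛₗ, J.map_smulₛₗ, hx, Complex.conj_conj]

/-- For a monomial `a` of degree `k`, `J (a^*) = n^{-k/2} a`. So the involution `(ξ, η) ↦ (ξ, J η²)`
of pairs, read as `J` applied once to the second entry, exchanges the graph of the star with that of
a diagonal operator on `O_{nc}`. -/
theorem mem_preTomita_graph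
    {J : (hS.kmsState τ hτ).GNS →ₛₗᵢ[starRingEnd ℂ] (hS.kmsState τ hτ).GNS}
    (hJJ : ∀ ξ, J (J ξ) = ξ) (hJ : ∀ μ ν : List (Fin n),
      J (gnsVector (hS.kmsState τ hτ) (cuntzMonomial S μ ν)) =
        ((√((n : ℝ) ^ ((μ.length : ℤ) - ν.length)) : ℝ) : ℂ) •
          gnsVector (hS.kmsState τ hτ) (cuntzMonomial S ν μ))
    (p : (hS.kmsState τ hτ).GNS × (hS.kmsState τ hτ).GNS) :
    p ∈ (preTomita S (hS.kmsState τ hτ)).graph ↔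
      (p.1, J p.2) ∈ Submodule.span ℂ {p | ∃ μ ν : List (Fin n),
        p = (gnsVector (hS.kmsState τ hτ) (cuntzMonomial S μ ν),
          ((√((n : ℝ) ^ (-((μ.length : ℤ) - ν.length))) : ℝ) : ℂ) •
            gnsVector (hS.kmsState τ hτ) (cuntzMonomial S μ ν))} := by
  constructor
  · rintro ⟨a, ha, rfl⟩
    change (gnsVector _ a, J (gnsVector _ (star a))) ∈ _
    induction ha using Submodule.span_induction with
    | mem x hx =>
      obtain ⟨μ, ν, rfl⟩ := hx
      rw [star_cuntzMonomial, hJ, ← neg_sub]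
      exact Submodule.subset_span ⟨μ, ν, rfl⟩
    | zero =>
      rw [star_zero, gnsVector_zero, map_zero]
      exact zero_mem _
    | add x y _ _ hx hy =>
      rw [star_add, gnsVector_add, gnsVector_add, map_add, ← Prod.mk_add_mk]
      exact add_mem hx hy
    | smul c x _ hx =>
      rw [star_smul, gnsVector_smul, gnsVector_smul, J.map_smulₛₗ, Complex.star_def,
        Complex.conj_conj, ← Prod.smul_mk]
      exact Submodule.smul_mem _ _ hx
  · intro hp
    have key : ∀ q ∈ Submodule.span ℂ {p | ∃ μ ν : List (Fin n),
        p = (gnsVector (hS.kmsState τ hτ) (cuntzMonomial S μ ν),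
          ((√((n : ℝ) ^ (-((μ.length : ℤ) - ν.length))) : ℝ) : ℂ) •
            gnsVector (hS.kmsState τ hτ) (cuntzMonomial S μ ν))},
        (q.1, J q.2) ∈ (preTomita S (hS.kmsState τ hτ)).graph := by
      intro q hq
      induction hq using Submodule.span_induction with
      | mem x hx =>
        obtain ⟨μ, ν, rfl⟩ := hx
        refine ⟨cuntzMonomial S μ ν, cuntzMonomial_mem_cuntzCore S μ ν, Prod.ext rfl ?_⟩
        have h := congrArg J (hJ ν μ)
        rw [hJJ] at h
        rw [star_cuntzMonomial, h, neg_sub]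
      | zero =>
        change (0, J 0) ∈ _
        rw [map_zero]
        exact zero_mem _
      | add x y _ _ hx hy =>
        have := add_mem hx hy
        rwa [Prod.mk_add_mk, ← map_add] at this
      | smul c x _ hx =>
        have := (preTomita S (hS.kmsState τ hτ)).smul_mem c _ hx
        rwa [← J.map_smulₛₗ] at this
    have := key _ hp
    rwa [hJJ] at this

/-- Applying `J` to the second coordinate is continuous and its own inverse, so it carries closures
to closures. -/
theorem mem_closure_preTomita_graph
    {J : (hS.kmsState τ hτ).GNS →ₛₗᵢ[starRingEnd ℂ] (hS.kmsState τ hτ).GNS}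
    (hJJ : ∀ ξ, J (J ξ) = ξ) (hJ : ∀ μ ν : List (Fin n),
      J (gnsVector (hS.kmsState τ hτ) (cuntzMonomial S μ ν)) =
        ((√((n : ℝ) ^ ((μ.length : ℤ) - ν.length)) : ℝ) : ℂ) •
          gnsVector (hS.kmsState τ hτ) (cuntzMonomial S ν μ))
    (p : (hS.kmsState τ hτ).GNS × (hS.kmsState τ hτ).GNS) :
    p ∈ (preTomita S (hS.kmsState τ hτ)).closure.graph ↔
      (p.1, J p.2) ∈ (diagonalOperator (degreeProjection S (hS.kmsState τ hτ))
        fun k => ((√((n : ℝ) ^ (-k)) : ℝ) : ℂ)).graph := by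
  rw [diagonalOperator_degreeProjection_graph]
  have hc : Continuous fun p : (hS.kmsState τ hτ).GNS × (hS.kmsState τ hτ).GNS =>
    (p.1, J p.2) := continuous_fst.prodMk (J.continuous.comp continuous_snd)
  constructor
  · intro hp
    exact map_mem_closure (f := fun p : (hS.kmsState τ hτ).GNS × (hS.kmsState τ hτ).GNS =>
      (p.1, J p.2)) hc hp fun q hq => (mem_preTomita_graph hS hτ hJJ hJ q).1 hq
  · intro hp
    have := map_mem_closure (f := fun p : (hS.kmsState τ hτ).GNS × (hS.kmsState τ hτ).GNS =>
      (p.1, J p.2)) hc hp (t := ((preTomita S (hS.kmsState τ hτ)).graph : Set _))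
      fun q hq => (mem_preTomita_graph hS hτ hJJ hJ (q.1, J q.2)).2 (by rw [hJJ]; exact hq)
    simp only [hJJ] at this
    exact this

end IsCuntzAlgebra

end Grading

/-! ### The modular operator in diagonal form, and the functional calculi of `Δ` and `D`. -/

namespace IsCuntzAlgebra

variable {n : ℕ} {A : Type*} [CStarAlgebra A] [PartialOrder A] [StarOrderedRing A] {S : Fin n → A}
  (hS : IsCuntzAlgebra S) {τ : hS.fixedPoints →ₗ[ℂ] ℂ} (hτ : hS.IsFaithfulNormalizedTrace τ)

theorem modularOperator_eq :
    modularOperator S (hS.kmsState τ hτ) =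
      diagonalOperator (degreeProjection S (hS.kmsState τ hτ))
        fun k => (((n : ℝ) ^ (-k) : ℝ) : ℂ) := by
  obtain ⟨J, hJJ, hJ⟩ := exists_modular_conjugation hS hτ
  have h := AntilinearRel.adjoint_comp_self_of_polar
    (isOrthogonalDecomposition_degreeProjection hS hτ) hJJ
    (mem_closure_preTomita_graph hS hτ hJJ hJ)
  have hsq : ∀ k : ℤ, √((n : ℝ) ^ (-k)) ^ 2 = (n : ℝ) ^ (-k) := fun k =>
    Real.sq_sqrt (by positivity)
  simp only [hsq] at h
  exact h

theorem isBorelFunctionOf_modularOperator {f : ℝ → ℂ} (hf : Measurable f) :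
    IsBorelFunctionOf (modularOperator S (hS.kmsState τ hτ)) f
      (diagonalOperator (degreeProjection S (hS.kmsState τ hτ)) fun k => f ((n : ℝ) ^ (-k))) := by
  rw [modularOperator_eq]
  exact (isOrthogonalDecomposition_degreeProjection hS hτ).isBorelFunctionOf_diagonalOperator
    (fun k : ℤ => (n : ℝ) ^ (-k)) hf

theorem isBorelFunctionOf_gaugeGenerator {f : ℝ → ℂ} (hf : Measurable f) :
    IsBorelFunctionOf (gaugeGenerator S (hS.kmsState τ hτ)) f
      (diagonalOperator (degreeProjection S (hS.kmsState τ hτ)) fun k => f k) := by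
  rw [gaugeGenerator_eq]
  exact (isOrthogonalDecomposition_degreeProjection hS hτ).isBorelFunctionOf_diagonalOperator
    (fun k : ℤ => (k : ℝ)) hf

end IsCuntzAlgebra

/-! ### Scalar identities for the eigenvalues. -/

theorem Circle.coe_exp_zpow (t : ℝ) (k : ℤ) :
    (Circle.exp t : ℂ) ^ k = Complex.exp (Complex.I * t * k) := by
  rw [Circle.coe_exp, ← Complex.exp_int_mul]
  congr 1
  ring

theorem Complex.natCast_zpow_eq_exp {n : ℕ} (hn : n ≠ 0) (k : ℤ) :
    (n : ℂ) ^ k = Complex.exp (k * Real.log n) := by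
  rw [Complex.exp_int_mul, ← Complex.ofReal_exp, Real.exp_log (by positivity),
    Complex.ofReal_natCast]

theorem Complex.natCast_zpow_cpow {n : ℕ} (hn : n ≠ 0) (k : ℤ) (s : ℂ) :
    (((n : ℝ) ^ k : ℝ) : ℂ) ^ s = Complex.exp (s * k * Real.log n) := by
  rw [Complex.cpow_def_of_ne_zero (Complex.ofReal_ne_zero.2 (by positivity)),
    ← Complex.ofReal_log (by positivity), Real.log_zpow]
  congr 1
  push_cast
  ring

end

theorem lemma8p2 {n : ℕ} (hn : 2 ≤ n) {A : Type*} [CStarAlgebra A] [PartialOrder A]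
    [StarOrderedRing A] (S : Fin n → A) (hS : IsCuntzAlgebra S)
    (τ : hS.fixedPoints →ₗ[ℂ] ℂ) (hτ : hS.IsFaithfulNormalizedTrace τ)
    (ω : A →ₚ[ℂ] ℂ) (hω : ω = hS.kmsState τ hτ) :
    -- `a ↦ a^*` on `O_{nc}` is well defined on the GNS space and closable
    (preTomita S ω).closure.IsFunctional ∧
    -- polar decomposition of its closure: `S = J Δ^{1/2}` with `J` antiunitary, `J² = 1`
    (∃ (J : ω.GNS →ₛₗᵢ[starRingEnd ℂ] ω.GNS) (Q : ω.GNS →ₗ.[ℂ] ω.GNS),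
      (∀ ξ, J (J ξ) = ξ) ∧
      IsBorelFunctionOf (modularOperator S ω) (fun x => (√x : ℂ)) Q ∧
      (∀ ξ, ξ ∈ (tomitaOperator S ω).domain ↔ ξ ∈ Q.domain) ∧
      ∀ (ξ : (tomitaOperator S ω).domain) (η : Q.domain), (ξ : ω.GNS) = η →
        tomitaOperator S ω ξ = J (Q η)) ∧
    -- `Δ (S_μ S_ν^*) = n^{|ν| - |μ|} S_μ S_ν^*`
    (∀ μ ν : List (Fin n),
      ∃ hd : gnsVector ω (cuntzMonomial S μ ν) ∈ (modularOperator S ω).domain,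
        modularOperator S ω ⟨gnsVector ω (cuntzMonomial S μ ν), hd⟩ =
          (n : ℂ) ^ ((ν.length : ℤ) - (μ.length : ℤ)) • gnsVector ω (cuntzMonomial S μ ν)) ∧
    -- `σ_t (S_μ S_ν^*) = Δ^{it} S_μ S_ν^* Δ^{-it} = n^{it(|ν| - |μ|)} S_μ S_ν^*`
    (∃ U : ℝ → ω.GNS →L[ℂ] ω.GNS,
      (∀ t : ℝ, IsBorelFunctionOf (modularOperator S ω)
        (fun x => (x : ℂ) ^ (Complex.I * t)) (everywhereDefined (U t))) ∧
      ∀ (t : ℝ) (μ ν : List (Fin n)),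
        U t * ω.gnsStarAlgHom (cuntzMonomial S μ ν) * U (-t) =
          (n : ℂ) ^ (Complex.I * t * ((ν.length : ℂ) - (μ.length : ℂ))) •
            ω.gnsStarAlgHom (cuntzMonomial S μ ν)) ∧
    -- `Δ = e^{-D log n}`
    IsBorelFunctionOf (gaugeGenerator S ω)
      (fun x => Complex.exp (-(x * Real.log n))) (modularOperator S ω) ∧
    -- `e^{itD} = e^{-(it / log n) log Δ}`, and this unitary implements the gauge action
    ∃ V : ℝ → ω.GNS →L[ℂ] ω.GNS,
      (∀ t : ℝ, IsBorelFunctionOf (gaugeGenerator S ω)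
        (fun x => Complex.exp (Complex.I * t * x)) (everywhereDefined (V t))) ∧
      (∀ t : ℝ, IsBorelFunctionOf (modularOperator S ω)
        (fun x => Complex.exp (-(Complex.I * t / Real.log n) * Real.log x))
        (everywhereDefined (V t))) ∧
      ∀ (t : ℝ) (a : A), V t (gnsVector ω a) = gnsVector ω (hS.gauge (Circle.exp t) a) := by

  subst hω
  have hn0 : n ≠ 0 := by omega
  have hlog : (Real.log n : ℂ) ≠ 0 := by
    exact_mod_cast (Real.log_pos (by exact_mod_cast (by omega : 1 < n))).ne'
  obtain ⟨J, hJJ, hJ⟩ := hS.exists_modular_conjugation hτ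
  have hP := hS.isOrthogonalDecomposition_degreeProjection hτ
  have hG := hS.mem_closure_preTomita_graph hτ hJJ hJ
  refine ⟨AntilinearRel.isFunctional_of_polar hP hG,
    ⟨J, _, hJJ, hS.isBorelFunctionOf_modularOperator hτ (by fun_prop),
      AntilinearRel.mem_domain_of_polar hJJ hG, AntilinearRel.toOperator_eq_of_polar hP hJJ hG⟩,
    -- On degree `k`, `Δ^{it}` is `n^{-itk} = (e^{-it log n})^k`, so it is the gauge unitary at
    -- angle `-t log n`.
    fun μ ν => ?_, ⟨fun t => hS.gaugeUnitary hτ (Circle.exp (-(t * Real.log n))), fun t => ?_,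
      fun t μ ν => ?_⟩, ?_,
    ⟨fun t => hS.gaugeUnitary hτ (Circle.exp t), fun t => ?_, fun t => ?_, fun t a =>
      hS.gaugeUnitary_gnsVector hτ _ a⟩⟩
  · have h := hS.diagonalOperator_gnsVector hτ (fun k => (((n : ℝ) ^ (-k) : ℝ) : ℂ)) μ ν
    rw [← hS.modularOperator_eq hτ, LinearPMap.mem_graph_iff] at h
    obtain ⟨⟨y, hy⟩, rfl, h⟩ := h
    refine ⟨hy, h.trans ?_⟩
    rw [Complex.ofReal_zpow, Complex.ofReal_natCast, neg_sub]
  · rw [IsCuntzAlgebra.everywhereDefined_gaugeUnitary]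
    convert hS.isBorelFunctionOf_modularOperator hτ
      (f := fun x => (x : ℂ) ^ (Complex.I * t)) (by fun_prop) using 2
    funext k
    rw [Circle.coe_exp_zpow, Complex.natCast_zpow_cpow hn0]
    congr 1
    push_cast
    ring
  · beta_reduce
    -- The unitary at `-t` is put in the form of the gauge unitary at the inverse circle element, so
    -- conjugation becomes the gauge action on the monomial.
    rw [neg_mul, Circle.exp_neg (-(t * Real.log n)), IsCuntzAlgebra.gaugeUnitary_conj,
      IsCuntzAlgebra.gauge_cuntzMonomial, map_smul, Circle.coe_exp_zpow,
      Complex.cpow_def_of_ne_zero (Nat.cast_ne_zero.2 hn0), ← Complex.natCast_log]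
    congr 2
    push_cast
    ring
  · convert hS.isBorelFunctionOf_gaugeGenerator hτ
      (f := fun x => Complex.exp (-(x * Real.log n))) (by fun_prop) using 1
    rw [hS.modularOperator_eq hτ]
    congr 1
    funext k
    rw [Complex.ofReal_zpow, Complex.ofReal_natCast, Complex.natCast_zpow_eq_exp hn0]
    push_cast
    congr 1
    ring
  · rw [IsCuntzAlgebra.everywhereDefined_gaugeUnitary]
    convert hS.isBorelFunctionOf_gaugeGenerator hτ
      (f := fun x => Complex.exp (Complex.I * t * x)) (by fun_prop) using 2
    funext k
    rw [Circle.coe_exp_zpow, Complex.ofReal_intCast]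
  · rw [IsCuntzAlgebra.everywhereDefined_gaugeUnitary]
    convert hS.isBorelFunctionOf_modularOperator hτ
      (f := fun x => Complex.exp (-(Complex.I * t / Real.log n) * Real.log x)) (by fun_prop) using 2
    funext k
    -- On degree `k` the logarithm of `Δ` is `-k log n`; dividing by `log n`, nonzero because `n ≥
    -- 2`, leaves the exponent `itk` of `e^{itD}`.
    rw [Circle.coe_exp_zpow, Real.log_zpow]
    congr 1
    rw [Complex.ofReal_mul, Complex.ofReal_intCast, Int.cast_neg]
    field_simp
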